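/- Let $A\subset\mathbb{R}^2$ be a finite point set, no three points of which are collinear, and let $\omega:A\to\mathbb{R}$ be a height function that is generic: no four of the lifted points $p'=(p,\omega(p))\in\mathbb{R}^3$, $p\in A$, lie on a common non-vertical plane. A triangulation of $A$ is a geometric simplicial complex with vertices in $A$ (not necessarily all of $A$) and underlying space $\mathrm{conv}(A)$. The regular (respectively, farthest point regular) triangulation of $(A,\omega)$ is the projection to $\mathbb{R}^2$ of the complex of lower (respectively, upper) faces of $\mathrm{conv}\{p' : p\in A\}$. A flip replaces, inside a triangulation of $A$, a subcomplex that triangulates a set $Z\subseteq A$ of four points by the other triangulation of $Z$; it is a down-flip if the upper faces of the lifted tetrahedron $\mathrm{conv}\{p' : p\in Z\}$ are replaced by its lower faces, and an up-flip if the lower faces are replaced by the upper ones. The poset of down-flips is the set of all triangulations of $A$ with $T_1\le T_2$ if $T_1$ arises from $T_2$ by a finite, possibly empty, sequence of down-flips; in the poset of up-flips, $T_1\le T_2$ if $T_2$ arises from $T_1$ by a finite, possibly empty, sequence of up-flips. Call $\omega$ convex (concave) if it is the restriction to $A$ of a convex (concave) function on $\mathrm{conv}(A)$. (1) If $\omega$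 is convex, then the down-flip relation $\le$ is a partial order, and it has a unique minimum, namely the regular triangulation of $(A,\omega)$. However, it need not have a maximum: there are such $A$ and convex $\omega$ for which no triangulation $M$ of $A$ satisfies $T\le M$ for all triangulations $T$ of $A$. (2) If $\omega$ is concave, then the up-flip relation $\le$ is a partial order, and it has a unique maximum, namely the farthest point regular triangulation of $(A,\omega)$. However, it need not have a minimum: there are such $A$ and concave $\omega$ for which no triangulation $M$ of $A$ satisfies $M\le T$ for all triangulations $T$ of $A$. -/

import Mathlib

namespace FlipPoset

/-- The Euclidean plane. -/
abbrev Plane : Type := EuclideanSpace ℝ (Fin 2)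

/-- A triangulation of a finite planar point set `A`: a geometric simplicial complex all of whose
vertices belong to `A` (not every point of `A` has to be used) and whose underlying space is
`conv A`. The empty simplex is left implicit, as everywhere in Mathlib. -/
structure Triangulation (A : Finset Plane) extends Geometry.SimplicialComplex ℝ Plane where
  subset_points : ∀ s ∈ faces, s ⊆ A
  space_eq : toSimplicialComplex.space = convexHull ℝ (A : Set Plane)

/-- General position: no three points of `A` are collinear. -/
def InGeneralPosition (A : Finset Plane) : Prop :=
  ∀ Z ⊆ A, Z.card = 3 → ¬ Collinear ℝ (Z : Set Plane)

/-- The heights are sufficiently generic: no four points of `A` are lifted to a common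
non-vertical plane, i.e. to the graph of an affine function. Only the values of `ω` on `A`
matter, here and in all definitions below. -/
def IsGeneric (A : Finset Plane) (ω : Plane → ℝ) : Prop :=
  ∀ Z ⊆ A, Z.card = 4 → ¬ ∃ h : Plane →ᵃ[ℝ] ℝ, ∀ p ∈ Z, h p = ω p

/-- The height function `ω : A → ℝ` is convex: it is the restriction to `A` of a convex function
on `conv A`. -/
def IsConvexHeight (A : Finset Plane) (ω : Plane → ℝ) : Prop :=
  ∃ f : Plane → ℝ, ConvexOn ℝ (convexHull ℝ (A : Set Plane)) f ∧ ∀ p ∈ A, f p = ω p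

/-- The height function `ω : A → ℝ` is concave: it is the restriction to `A` of a concave function
on `conv A`. -/
def IsConcaveHeight (A : Finset Plane) (ω : Plane → ℝ) : Prop :=
  ∃ f : Plane → ℝ, ConcaveOn ℝ (convexHull ℝ (A : Set Plane)) f ∧ ∀ p ∈ A, f p = ω p

/-- `conv (S^ω)`, the convex hull in space of the lifted points `(p, ω p)`, `p ∈ S`. -/
def liftedHull (S : Finset Plane) (ω : Plane → ℝ) : Set (Plane × ℝ) :=
  convexHull ℝ ((fun p => (p, ω p)) '' (S : Set Plane))

/-- `F` is a face (of any dimension) of `conv (S^ω)` visible from below: it is cut out by a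
non-vertical plane, the graph of `h`, and `conv (S^ω)` lies on or above this plane. -/
def IsLowerFace (S : Finset Plane) (ω : Plane → ℝ) (F : Set (Plane × ℝ)) : Prop :=
  ∃ h : Plane →ᵃ[ℝ] ℝ,
    (∀ x ∈ liftedHull S ω, h x.1 ≤ x.2) ∧ F = {x ∈ liftedHull S ω | x.2 = h x.1}

/-- `F` is a face (of any dimension) of `conv (S^ω)` visible from above: it is cut out by a
non-vertical plane, the graph of `h`, and `conv (S^ω)` lies on or below this plane. -/
def IsUpperFace (S : Finset Plane) (ω : Plane → ℝ) (F : Set (Plane × ℝ)) : Prop :=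
  ∃ h : Plane →ᵃ[ℝ] ℝ,
    (∀ x ∈ liftedHull S ω, x.2 ≤ h x.1) ∧ F = {x ∈ liftedHull S ω | x.2 = h x.1}

/-- The projections to the plane, recorded by their vertices, of the lower faces of `conv (S^ω)`. -/
def lowerFaces (S : Finset Plane) (ω : Plane → ℝ) : Set (Finset Plane) :=
  {s | s.Nonempty ∧ s ⊆ S ∧ IsLowerFace S ω (liftedHull s ω)}

/-- The projections to the plane, recorded by their vertices, of the upper faces of `conv (S^ω)`. -/
def upperFaces (S : Finset Plane) (ω : Plane → ℝ) : Set (Finset Plane) :=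
  {s | s.Nonempty ∧ s ⊆ S ∧ IsUpperFace S ω (liftedHull s ω)}

/-- `T` is the regular triangulation of `(A, ω)`. -/
def Triangulation.IsRegularOf {A : Finset Plane} (T : Triangulation A) (ω : Plane → ℝ) : Prop :=
  T.faces = lowerFaces A ω

/-- `T` is the farthest point regular triangulation of `(A, ω)`. -/
def Triangulation.IsFarthestRegularOf {A : Finset Plane} (T : Triangulation A)
    (ω : Plane → ℝ) : Prop :=
  T.faces = upperFaces A ω

/-- `T₂` arises from `T₁` by the flip with support `Z`, a set of four points of `A`: a subcomplex
`K₁` of `T₁` that triangulates `Z` is replaced by the other triangulation `K₂` of `Z`. -/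
structure IsFlip {A Z : Finset Plane} (T₁ T₂ : Triangulation A) (K₁ K₂ : Triangulation Z) :
    Prop where
  support_subset : Z ⊆ A
  support_card : Z.card = 4
  ne : K₁ ≠ K₂
  subcomplex : K₁.faces ⊆ T₁.faces
  replace : T₂.faces = (T₁.faces \ K₁.faces) ∪ K₂.faces

/-- A down-flip: the upper faces of the lifted tetrahedron are replaced by its lower faces. -/
def IsDownFlip {A : Finset Plane} (ω : Plane → ℝ) (T₁ T₂ : Triangulation A) : Prop :=
  ∃ (Z : Finset Plane) (K₁ K₂ : Triangulation Z),
    IsFlip T₁ T₂ K₁ K₂ ∧ K₁.faces = upperFaces Z ω ∧ K₂.faces = lowerFaces Z ω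

/-- An up-flip: the lower faces of the lifted tetrahedron are replaced by its upper faces. -/
def IsUpFlip {A : Finset Plane} (ω : Plane → ℝ) (T₁ T₂ : Triangulation A) : Prop :=
  ∃ (Z : Finset Plane) (K₁ K₂ : Triangulation Z),
    IsFlip T₁ T₂ K₁ K₂ ∧ K₁.faces = lowerFaces Z ω ∧ K₂.faces = upperFaces Z ω

/-- The order of the poset of down-flips: `T₁ ≤ T₂` if `T₁` can be produced from `T₂` by a
(possibly empty) sequence of down-flips. -/
def DownLE {A : Finset Plane} (ω : Plane → ℝ) (T₁ T₂ : Triangulation A) : Prop :=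
  Relation.ReflTransGen (IsDownFlip ω) T₂ T₁

/-- The order of the poset of up-flips: `T₁ ≤ T₂` if `T₂` can be produced from `T₁` by a
(possibly empty) sequence of up-flips. -/
def UpLE {A : Finset Plane} (ω : Plane → ℝ) (T₁ T₂ : Triangulation A) : Prop :=
  Relation.ReflTransGen (IsUpFlip ω) T₁ T₂

/-- `M` is the unique minimum of the relation `le`. -/
def IsUniqueMinimum {α : Type} (le : α → α → Prop) (M : α) : Prop :=
  (∀ T, le M T) ∧ ∀ N, (∀ T, le N T) → N = M

/-- `M` is the unique maximum of the relation `le`. -/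
def IsUniqueMaximum {α : Type} (le : α → α → Prop) (M : α) : Prop :=
  (∀ T, le T M) ∧ ∀ N, (∀ T, le T N) → N = M

end FlipPoset

/-! A triangulation `T` lifts to the piecewise linear function `T.liftHeight ω` that interpolates
`ω` on its simplices. A down-flip never raises this function and lowers it somewhere
(`IsDownFlip.liftHeight_lt`). So flips cannot cycle, which gives antisymmetry, and since there are
finitely many triangulations every descent ends in one without down-flips
(`exists_minimal_of_downFlip`).

Convexity of `ω` ensures that such a final triangulation is the regular one. A point of `A` that is
not a vertex lies inside a triangle and, by convexity, its lift lies below the lifted triangle, so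
inserting it is a down-flip (`singleton_mem_faces_or_exists_downFlip`). At a locally non-convex edge
the two triangles form a convex quadrilateral, because otherwise an endpoint of the edge would lie
in the triangle of the other three points and contradict convexity; hence the edge can be flipped
down (`exists_downFlip_of_edge`). What remains is a locally convex lift through all points, and a
walk along a segment turns local into global convexity (`affineMap_le_of_forall_not_downFlip`).

There is no maximum for a suitable pinwheel of six points. The edges 13, 24, 05 of the lower hull
partition the points into pairs, so any four points contain such a pair and every down-flip creates
one of these edges. A triangulation with none of them can only be reached from itself, and there are
two: the outer triangle alone, and the regular triangulation with all three edges flipped. Part (2)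
is part (1) for `-ω`. -/

namespace FlipPoset

/-! ### Convex combinations and affine functions on finite sets -/

open scoped Classical in
theorem affineIndependent_finset_weights {s : Finset Plane}
    (hs : AffineIndependent ℝ ((↑) : s → Plane)) {w : Plane → ℝ}
    (h0 : ∑ p ∈ s, w p = 0) (h1 : ∑ p ∈ s, w p • p = 0) : ∀ p ∈ s, w p = 0 := by
  intro p hp
  have := (affineIndependent_iff.1 hs) Finset.univ (fun q => w q)
    (by rw [← h0]; exact Finset.sum_coe_sort s w)
    (by rw [← h1]; exact Finset.sum_coe_sort s (fun q => w q • q))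
  exact this ⟨p, hp⟩ (Finset.mem_univ _)

/-- Affine maps to the reals commute with affine combinations. -/
theorem affineMap_sum (h : Plane →ᵃ[ℝ] ℝ) {s : Finset Plane} {w : Plane → ℝ}
    (hw : ∑ p ∈ s, w p = 1) : h (∑ p ∈ s, w p • p) = ∑ p ∈ s, w p * h p := by
  have hd : ∀ x, h x = h.linear x + h 0 := fun x => congrFun h.decomp x
  rw [hd, map_sum]
  simp only [map_smul, smul_eq_mul]
  have : ∀ p ∈ s, w p * h p = w p * h.linear p + w p * h 0 := fun p _ => by rw [hd p]; ring
  rw [Finset.sum_congr rfl this, Finset.sum_add_distrib, ← Finset.sum_mul, hw, one_mul]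

/-- `x` is a convex combination of all points of `s` with positive weights. -/
def InRel (s : Finset Plane) (x : Plane) : Prop :=
  ∃ w : Plane → ℝ, (∀ p ∈ s, 0 < w p) ∧ ∑ p ∈ s, w p = 1 ∧ ∑ p ∈ s, w p • p = x

theorem InRel.mem_convexHull {s : Finset Plane} {x : Plane} (h : InRel s x) :
    x ∈ convexHull ℝ (s : Set Plane) := by
  obtain ⟨w, h0, h1, h2⟩ := h
  exact Finset.mem_convexHull'.2 ⟨w, fun p hp => (h0 p hp).le, h1, h2⟩

theorem InRel.nonempty {s : Finset Plane} {x : Plane} (h : InRel s x) : s.Nonempty := by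
  obtain ⟨w, -, h1, -⟩ := h
  rw [Finset.nonempty_iff_ne_empty]
  rintro rfl
  simp at h1

theorem inRel_singleton (p : Plane) : InRel {p} p := ⟨fun _ => 1, by simp, by simp, by simp⟩

theorem exists_inRel {s : Finset Plane} (hs : s.Nonempty) : ∃ x, InRel s x := by
  have hc : (0 : ℝ) < s.card := by exact_mod_cast hs.card_pos
  refine ⟨_, fun _ => (s.card : ℝ)⁻¹, fun _ _ => by positivity, ?_, rfl⟩
  simp [hc.ne']

theorem exists_inRel_subset {s : Finset Plane} {x : Plane}
    (hx : x ∈ convexHull ℝ (s : Set Plane)) : ∃ u ⊆ s, InRel u x := by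
  obtain ⟨w, h0, h1, h2⟩ := Finset.mem_convexHull'.1 hx
  refine ⟨s.filter (fun p => w p ≠ 0), Finset.filter_subset _ _, w, ?_, ?_, ?_⟩
  · intro p hp
    rw [Finset.mem_filter] at hp
    exact lt_of_le_of_ne (h0 p hp.1) (Ne.symm hp.2)
  · rw [Finset.sum_filter_ne_zero, h1]
  · rw [← h2]
    refine Finset.sum_subset (Finset.filter_subset _ _) fun p hp hp' => ?_
    have : w p = 0 := by
      by_contra h
      exact hp' (Finset.mem_filter.2 ⟨hp, h⟩)
    simp [this]

-- Barycentric coordinates over `s` are unique, so the positive weights on `u` must reappear as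
-- weights on `t`.
open scoped Classical in
theorem InRel.subset_of_mem {s t u : Finset Plane} {x : Plane}
    (hs : AffineIndependent ℝ ((↑) : s → Plane)) (hu : u ⊆ s) (ht : t ⊆ s) (hx : InRel u x)
    (hxt : x ∈ convexHull ℝ (t : Set Plane)) : u ⊆ t := by
  obtain ⟨w, w0, w1, w2⟩ := hx
  obtain ⟨v, v0, v1, v2⟩ := Finset.mem_convexHull'.1 hxt
  have key := affineIndependent_finset_weights hs
    (w := fun p => (if p ∈ u then w p else 0) - (if p ∈ t then v p else 0)) (by
      rw [Finset.sum_sub_distrib, Finset.sum_ite_mem, Finset.sum_ite_mem,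
        Finset.inter_eq_right.2 hu, Finset.inter_eq_right.2 ht, w1, v1, sub_self]) (by
      simp only [sub_smul, ite_smul, zero_smul]
      rw [Finset.sum_sub_distrib, Finset.sum_ite_mem, Finset.sum_ite_mem,
        Finset.inter_eq_right.2 hu, Finset.inter_eq_right.2 ht, w2, v2, sub_self])
  intro p hp
  by_contra hpt
  have := key p (hu hp)
  simp only [hp, hpt, if_true, if_false, sub_zero] at this
  exact (w0 p hp).ne' this

/-- Complementary slackness: with positive weights no term can be strict. This is how equality of
heights at one point becomes membership of vertices in a face. -/
theorem eq_of_weighted_sum_le {s : Finset Plane} {w a b : Plane → ℝ} (hw : ∀ p ∈ s, 0 < w p)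
    (hab : ∀ p ∈ s, a p ≤ b p) (h : ∑ p ∈ s, w p * b p ≤ ∑ p ∈ s, w p * a p) :
    ∀ p ∈ s, a p = b p := by
  have hle : ∀ p ∈ s, w p * a p ≤ w p * b p :=
    fun p hp => mul_le_mul_of_nonneg_left (hab p hp) (hw p hp).le
  have := (Finset.sum_eq_sum_iff_of_le hle).1 (le_antisymm (Finset.sum_le_sum hle) h)
  exact fun p hp => mul_left_cancel₀ (hw p hp).ne' (this p hp)

/-- An affine function that is nonpositive on `s` and vanishes at a relatively interior point of
`conv s` vanishes on `s`. -/
theorem InRel.eq_of_le {s : Finset Plane} {x : Plane} (hx : InRel s x) {g h : Plane →ᵃ[ℝ] ℝ}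
    (hle : ∀ p ∈ s, g p ≤ h p) (he : h x ≤ g x) : ∀ p ∈ s, g p = h p := by
  obtain ⟨w, w0, w1, rfl⟩ := hx
  rw [affineMap_sum _ w1, affineMap_sum _ w1] at he
  exact eq_of_weighted_sum_le w0 hle he

theorem affineMap_le_of_mem_convexHull {s : Finset Plane} {x : Plane}
    (hx : x ∈ convexHull ℝ (s : Set Plane)) {g h : Plane →ᵃ[ℝ] ℝ}
    (hle : ∀ p ∈ s, g p ≤ h p) : g x ≤ h x := by
  obtain ⟨w, w0, w1, rfl⟩ := Finset.mem_convexHull'.1 hx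
  rw [affineMap_sum _ w1, affineMap_sum _ w1]
  exact Finset.sum_le_sum fun p hp => mul_le_mul_of_nonneg_left (hle p hp) (w0 p hp)

theorem affineMap_eq_of_mem_convexHull {s : Finset Plane} {x : Plane}
    (hx : x ∈ convexHull ℝ (s : Set Plane)) {g h : Plane →ᵃ[ℝ] ℝ}
    (he : ∀ p ∈ s, g p = h p) : g x = h x :=
  le_antisymm (affineMap_le_of_mem_convexHull hx fun p hp => (he p hp).le)
    (affineMap_le_of_mem_convexHull hx fun p hp => (he p hp).ge)

/-- Affine interpolation on an affinely independent set. -/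
theorem exists_affineMap_eq {s : Finset Plane} (hs : AffineIndependent ℝ ((↑) : s → Plane))
    (v : Plane → ℝ) : ∃ h : Plane →ᵃ[ℝ] ℝ, ∀ p ∈ s, h p = v p := by
  obtain ⟨t, hst, ht, htop⟩ :=
    exists_subset_affineIndependent_affineSpan_eq_top (k := ℝ) (s := (s : Set Plane)) hs
  let b : AffineBasis t ℝ Plane := ⟨(↑), ht, by simpa using htop⟩
  have : Finite t := finite_set_of_fin_dim_affineIndependent ℝ ht
  let _ : Fintype t := Fintype.ofFinite t
  refine ⟨∑ i : t, v i • b.coord i, fun p hp => ?_⟩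
  have hb : b ⟨p, hst hp⟩ = p := rfl
  have h1 : (∑ i : t, v i • b.coord i) p = ∑ i : t, v i * b.coord i p := by
    have : ∀ (f : t → (Plane →ᵃ[ℝ] ℝ)) (S : Finset t), (∑ i ∈ S, f i) p = ∑ i ∈ S, f i p := by
      classical
      intro f S
      induction S using Finset.induction_on with
      | empty => simp
      | insert a S ha ih => rw [Finset.sum_insert ha, Finset.sum_insert ha, ← ih]; rfl
    rw [this]; rfl
  rw [h1]
  conv_lhs => rw [← hb]
  classical
  simp [AffineBasis.coord_apply]

/-! ### General position, genericity and convex heights -/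

theorem InGeneralPosition.mono {A B : Finset Plane} (h : InGeneralPosition A) (hB : B ⊆ A) :
    InGeneralPosition B := fun Z hZ => h Z (hZ.trans hB)

theorem IsGeneric.mono {A B : Finset Plane} {ω : Plane → ℝ} (h : IsGeneric A ω) (hB : B ⊆ A) :
    IsGeneric B ω := fun Z hZ => h Z (hZ.trans hB)

theorem IsGeneric.neg {A : Finset Plane} {ω : Plane → ℝ} (h : IsGeneric A ω) :
    IsGeneric A (-ω) := by
  rintro Z hZ hc ⟨g, hg⟩
  exact h Z hZ hc ⟨-g, fun p hp => by
    have := hg p hp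
    simp only [Pi.neg_apply] at this
    simp [this]⟩

theorem InGeneralPosition.affineIndependent_of_card_eq {A s : Finset Plane}
    (hA : InGeneralPosition A) (hs : s ⊆ A) (hc : s.card = 3) :
    AffineIndependent ℝ ((↑) : s → Plane) := by
  rw [affineIndependent_iff_not_finrank_vectorSpan_le ℝ _ (n := 1) (by simp [hc]),
    ← collinear_iff_finrank_le_one]
  simpa using hA s hs hc

theorem InGeneralPosition.affineIndependent {A s : Finset Plane} (hA : InGeneralPosition A)
    (hs : s ⊆ A) (hc : s.card ≤ 3) : AffineIndependent ℝ ((↑) : s → Plane) := by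
  have h4 : s.card = 0 ∨ s.card = 1 ∨ s.card = 2 ∨ s.card = 3 := by omega
  rcases h4 with h | h | h | h
  · rw [Finset.card_eq_zero] at h
    subst h
    exact affineIndependent_of_subsingleton ℝ _
  · obtain ⟨a, rfl⟩ := Finset.card_eq_one.1 h
    exact affineIndependent_of_subsingleton ℝ _
  · rw [affineIndependent_iff_not_finrank_vectorSpan_le ℝ _ (n := 0) (by simp [h])]
    obtain ⟨a, b, hab, rfl⟩ := Finset.card_eq_two.1 h
    intro h0
    have h1 := Nat.le_zero.1 h0
    rw [Submodule.finrank_eq_zero] at h1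
    rw [vectorSpan_eq_bot_iff_subsingleton] at h1
    exact hab (h1 ⟨⟨a, by simp⟩, rfl⟩ ⟨⟨b, by simp⟩, rfl⟩)
  · exact hA.affineIndependent_of_card_eq hs h

theorem affineSpan_eq_top_of_card {t : Finset Plane}
    (ht : AffineIndependent ℝ ((↑) : t → Plane)) (hc : t.card = 3) :
    affineSpan ℝ (t : Set Plane) = ⊤ := by
  have := ht.affineSpan_eq_top_iff_card_eq_finrank_add_one
  simpa [hc] using this

/-- Barycentric coordinates with respect to a triangle. -/
theorem exists_barycentric {t : Finset Plane} (ht : AffineIndependent ℝ ((↑) : t → Plane))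
    (hc : t.card = 3) (x : Plane) :
    ∃ w : Plane → ℝ, ∑ p ∈ t, w p = 1 ∧ ∑ p ∈ t, w p • p = x := by
  have hx : x ∈ affineSpan ℝ (Set.range ((↑) : t → Plane)) := by
    have := affineSpan_eq_top_of_card ht hc
    simp [this]
  obtain ⟨w, w1, w2⟩ := eq_affineCombination_of_mem_affineSpan_of_fintype hx
  classical
  refine ⟨fun p => if h : p ∈ t then w ⟨p, h⟩ else 0, ?_, ?_⟩
  · rw [← w1, ← Finset.sum_coe_sort]
    simp
  · rw [w2, Finset.affineCombination_eq_linear_combination _ _ _ w1, ← Finset.sum_coe_sort]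
    simp

theorem affineMap_eq_of_eq_on_triangle {t : Finset Plane}
    (ht : AffineIndependent ℝ ((↑) : t → Plane)) (hc : t.card = 3) {g h : Plane →ᵃ[ℝ] ℝ}
    (he : ∀ p ∈ t, g p = h p) (x : Plane) : g x = h x := by
  obtain ⟨w, w1, rfl⟩ := exists_barycentric ht hc x
  rw [affineMap_sum _ w1, affineMap_sum _ w1]
  exact Finset.sum_congr rfl fun p hp => by rw [he p hp]

theorem interior_convexHull_nonempty_of_triangle {t : Finset Plane}
    (ht : AffineIndependent ℝ ((↑) : t → Plane)) (hc : t.card = 3) :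
    (interior (convexHull ℝ (t : Set Plane))).Nonempty :=
  interior_convexHull_nonempty_iff_affineSpan_eq_top.2 (affineSpan_eq_top_of_card ht hc)

theorem IsConvexHeight.le_sum {A s : Finset Plane} {ω : Plane → ℝ} (h : IsConvexHeight A ω)
    (hs : s ⊆ A) {w : Plane → ℝ} (w0 : ∀ p ∈ s, 0 ≤ w p) (w1 : ∑ p ∈ s, w p = 1)
    (hx : ∑ p ∈ s, w p • p ∈ A) : ω (∑ p ∈ s, w p • p) ≤ ∑ p ∈ s, w p * ω p := by
  obtain ⟨f, hf, he⟩ := h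
  have h1 : ∑ p ∈ s, w p * ω p = ∑ p ∈ s, w p * f p :=
    Finset.sum_congr rfl fun p hp => by rw [he p (hs hp)]
  rw [← he _ hx, h1]
  simpa using hf.map_sum_le w0 w1 fun p hp => subset_convexHull ℝ _ (hs hp)

/-! ### Lifted hulls and the reflection that exchanges upper and lower faces -/

open scoped Classical in
theorem mem_liftedHull {S : Finset Plane} {ω : Plane → ℝ} {x : Plane} {y : ℝ} :
    (x, y) ∈ liftedHull S ω ↔ ∃ w : Plane → ℝ, (∀ p ∈ S, 0 ≤ w p) ∧ ∑ p ∈ S, w p = 1 ∧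
      ∑ p ∈ S, w p • p = x ∧ ∑ p ∈ S, w p * ω p = y := by
  have hinj : Function.Injective (fun p : Plane => (p, ω p)) := fun p q h => congrArg Prod.fst h
  have himg : ((fun p : Plane => (p, ω p)) '' (S : Set Plane)) =
      ((S.image fun p => (p, ω p) : Finset (Plane × ℝ)) : Set (Plane × ℝ)) := by simp
  rw [liftedHull, himg, Finset.mem_convexHull']
  constructor
  · rintro ⟨w, w0, w1, w2⟩
    rw [Finset.sum_image hinj.injOn] at w1 w2
    refine ⟨fun p => w (p, ω p), fun p hp => w0 _ (Finset.mem_image_of_mem _ hp), w1, ?_, ?_⟩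
    · simpa [Prod.fst_sum] using congrArg Prod.fst w2
    · simpa [Prod.snd_sum] using congrArg Prod.snd w2
  · rintro ⟨w, w0, w1, w2, w3⟩
    refine ⟨fun q => w q.1, ?_, ?_, ?_⟩
    · intro q hq
      obtain ⟨p, hp, rfl⟩ := Finset.mem_image.1 hq
      exact w0 p hp
    · rwa [Finset.sum_image hinj.injOn]
    · rw [Finset.sum_image hinj.injOn]
      refine Prod.ext ?_ ?_
      · simpa [Prod.fst_sum] using w2
      · simpa [Prod.snd_sum] using w3

theorem mem_liftedHull_of_mem {S : Finset Plane} {ω : Plane → ℝ} {p : Plane} (hp : p ∈ S) :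
    (p, ω p) ∈ liftedHull S ω := subset_convexHull ℝ _ ⟨p, hp, rfl⟩

theorem liftedHull_mono {S S' : Finset Plane} (ω : Plane → ℝ) (h : S ⊆ S') :
    liftedHull S ω ⊆ liftedHull S' ω :=
  convexHull_mono (Set.image_mono (by exact_mod_cast h))

theorem mem_convexHull_of_mem_liftedHull {S : Finset Plane} {ω : Plane → ℝ} {x : Plane} {y : ℝ}
    (h : (x, y) ∈ liftedHull S ω) : x ∈ convexHull ℝ (S : Set Plane) := by
  obtain ⟨w, w0, w1, w2, -⟩ := mem_liftedHull.1 h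
  exact Finset.mem_convexHull'.2 ⟨w, w0, w1, w2⟩

theorem exists_mem_liftedHull {S : Finset Plane} (ω : Plane → ℝ) {x : Plane}
    (h : x ∈ convexHull ℝ (S : Set Plane)) : ∃ y, (x, y) ∈ liftedHull S ω := by
  obtain ⟨w, w0, w1, w2⟩ := Finset.mem_convexHull'.1 h
  exact ⟨_, mem_liftedHull.2 ⟨w, w0, w1, w2, rfl⟩⟩

theorem neg_mem_liftedHull_neg {S : Finset Plane} {ω : Plane → ℝ} {x : Plane} {y : ℝ} :
    (x, -y) ∈ liftedHull S (-ω) ↔ (x, y) ∈ liftedHull S ω := by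
  simp [mem_liftedHull]

/-- The reflection `(x, y) ↦ (x, -y)` carries one lifted hull to the other, so only lower faces have
to be studied. -/
theorem isUpperFace_iff_neg {S s : Finset Plane} {ω : Plane → ℝ} :
    IsUpperFace S ω (liftedHull s ω) ↔ IsLowerFace S (-ω) (liftedHull s (-ω)) := by
  constructor
  · rintro ⟨h, h1, h2⟩
    refine ⟨-h, ?_, ?_⟩
    · rintro ⟨x, y⟩ hx
      have := h1 (x, -y) (neg_mem_liftedHull_neg.1 (by simpa using hx))
      simp only [AffineMap.coe_neg, Pi.neg_apply] at this ⊢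
      linarith
    · ext ⟨x, y⟩
      have := Set.ext_iff.1 h2 (x, -y)
      rw [Set.mem_ofPred_eq, ← neg_mem_liftedHull_neg (S := s) (ω := ω),
        ← neg_mem_liftedHull_neg (S := S) (ω := ω), neg_neg, neg_eq_iff_eq_neg] at this
      exact this
  · rintro ⟨h, h1, h2⟩
    refine ⟨-h, ?_, ?_⟩
    · rintro ⟨x, y⟩ hx
      have := h1 (x, -y) (neg_mem_liftedHull_neg.2 hx)
      simp only [AffineMap.coe_neg, Pi.neg_apply] at this ⊢
      linarith
    · ext ⟨x, y⟩
      have := Set.ext_iff.1 h2 (x, -y)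
      rw [neg_mem_liftedHull_neg, Set.mem_ofPred_eq, neg_mem_liftedHull_neg] at this
      simpa [neg_eq_iff_eq_neg] using this

theorem upperFaces_eq_lowerFaces_neg (S : Finset Plane) (ω : Plane → ℝ) :
    upperFaces S ω = lowerFaces S (-ω) := by
  ext s
  simp only [upperFaces, lowerFaces, Set.mem_ofPred_eq, isUpperFace_iff_neg]

/-! ### Lower faces as contact sets of affine functions -/

/-- `s` is the set of points of `A` at which an affine function below `ω` touches `ω`. -/
def IsTight (A : Finset Plane) (ω : Plane → ℝ) (s : Finset Plane) : Prop :=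
  s.Nonempty ∧ s ⊆ A ∧ ∃ h : Plane →ᵃ[ℝ] ℝ,
    (∀ p ∈ s, h p = ω p) ∧ ∀ p ∈ A, p ∉ s → h p < ω p

/-- A convex combination of lifted points reaches the plane of `h` only if all its weight sits where
`h` touches `ω`. -/
theorem IsTight.mem_lowerFaces {A s : Finset Plane} {ω : Plane → ℝ} (hs : IsTight A ω s) :
    s ∈ lowerFaces A ω := by
  obtain ⟨hne, hsA, h, he, hlt⟩ := hs
  have hle : ∀ p ∈ A, h p ≤ ω p := fun p hp => by
    by_cases hps : p ∈ s
    · exact (he p hps).le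
    · exact (hlt p hp hps).le
  refine ⟨hne, hsA, h, ?_, ?_⟩
  · rintro ⟨x, y⟩ hx
    obtain ⟨w, w0, w1, rfl, rfl⟩ := mem_liftedHull.1 hx
    simp only [affineMap_sum h w1]
    exact Finset.sum_le_sum fun p hp => mul_le_mul_of_nonneg_left (hle p hp) (w0 p hp)
  · ext ⟨x, y⟩
    constructor
    · intro hx
      refine ⟨liftedHull_mono ω hsA hx, ?_⟩
      obtain ⟨w, w0, w1, rfl, rfl⟩ := mem_liftedHull.1 hx
      simp only [affineMap_sum h w1]
      exact Finset.sum_congr rfl fun p hp => by rw [he p hp]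
    · rintro ⟨hx, hy⟩
      obtain ⟨w, w0, w1, rfl, rfl⟩ := mem_liftedHull.1 hx
      simp only [affineMap_sum h w1] at hy
      have hle' : ∀ p ∈ A, w p * h p ≤ w p * ω p :=
        fun p hp => mul_le_mul_of_nonneg_left (hle p hp) (w0 p hp)
      have heq := (Finset.sum_eq_sum_iff_of_le hle').1 hy.symm
      have hz : ∀ p ∈ A, p ∉ s → w p = 0 := by
        intro p hp hps
        by_contra hw
        exact (hlt p hp hps).ne (mul_left_cancel₀ hw (heq p hp))
      refine mem_liftedHull.2 ⟨w, fun p hp => w0 p (hsA hp), ?_, ?_, ?_⟩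
      · rw [← w1]; exact Finset.sum_subset hsA hz
      · exact Finset.sum_subset hsA fun p hp hps => by simp [hz p hp hps]
      · exact Finset.sum_subset hsA fun p hp hps => by simp [hz p hp hps]

theorem card_le_three_of_eq_affineMap {A B : Finset Plane} {ω : Plane → ℝ}
    (hg : IsGeneric A ω) (hB : B ⊆ A) (h : Plane →ᵃ[ℝ] ℝ) (hh : ∀ p ∈ B, h p = ω p) :
    B.card ≤ 3 := by
  by_contra hc
  obtain ⟨Z, hZ, hZc⟩ := Finset.exists_subset_card_eq (s := B) (n := 4) (by omega)
  exact hg Z (hZ.trans hB) hZc ⟨h, fun p hp => hh p (hZ hp)⟩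

/-- By genericity `h` touches `ω` in at most three points, which are affinely independent; a contact
point in the hull of `s` is therefore a point of `s`. -/
theorem isTight_of_mem_lowerFaces {A s : Finset Plane} {ω : Plane → ℝ}
    (hA : InGeneralPosition A) (hg : IsGeneric A ω) (hs : s ∈ lowerFaces A ω) :
    IsTight A ω s := by
  obtain ⟨hne, hsA, h, h1, h2⟩ := hs
  have hle : ∀ p ∈ A, h p ≤ ω p := fun p hp => h1 _ (mem_liftedHull_of_mem hp)
  have he : ∀ p ∈ s, h p = ω p := fun p hp => by
    have : (p, ω p) ∈ liftedHull s ω := mem_liftedHull_of_mem hp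
    rw [h2] at this
    exact this.2.symm
  refine ⟨hne, hsA, h, he, fun p hp hps => lt_of_le_of_ne (hle p hp) fun heq => hps ?_⟩
  have hB : A.filter (fun q => h q = ω q) ⊆ A := Finset.filter_subset _ _
  have hc := card_le_three_of_eq_affineMap hg hB h fun q hq => (Finset.mem_filter.1 hq).2
  have hi := hA.affineIndependent hB hc
  have hmem : (p, ω p) ∈ liftedHull s ω := by
    rw [h2]
    exact ⟨mem_liftedHull_of_mem hp, heq.symm⟩
  exact Finset.singleton_subset_iff.1 <| (inRel_singleton p).subset_of_mem hi
    (Finset.singleton_subset_iff.2 (Finset.mem_filter.2 ⟨hp, heq⟩))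
    (fun q hq => Finset.mem_filter.2 ⟨hsA hq, he q hq⟩) (mem_convexHull_of_mem_liftedHull hmem)

theorem mem_lowerFaces_iff {A s : Finset Plane} {ω : Plane → ℝ}
    (hA : InGeneralPosition A) (hg : IsGeneric A ω) : s ∈ lowerFaces A ω ↔ IsTight A ω s :=
  ⟨isTight_of_mem_lowerFaces hA hg, IsTight.mem_lowerFaces⟩

theorem IsTight.card_le {A s : Finset Plane} {ω : Plane → ℝ} (hs : IsTight A ω s)
    (hg : IsGeneric A ω) : s.card ≤ 3 := by
  obtain ⟨-, hsA, h, he, -⟩ := hs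
  exact card_le_three_of_eq_affineMap hg hsA h he

theorem IsTight.restrict {A Z s : Finset Plane} {ω : Plane → ℝ} (hs : IsTight A ω s)
    (hZ : Z ⊆ A) (hsZ : s ⊆ Z) : IsTight Z ω s := by
  obtain ⟨hne, -, h, he, hlt⟩ := hs
  exact ⟨hne, hsZ, h, he, fun p hp hps => hlt p (hZ hp) hps⟩

/-- The supporting plane is tilted: `g` is `0` on `u` and `-1` on the rest of `s`, and a small
multiple of `g` preserves the finitely many strict inequalities off `s`. -/
theorem IsTight.mono {A s u : Finset Plane} {ω : Plane → ℝ} (hs : IsTight A ω s)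
    (hA : InGeneralPosition A) (hg : IsGeneric A ω) (hu : u ⊆ s) (hne : u.Nonempty) :
    IsTight A ω u := by
  have hc := hs.card_le hg
  obtain ⟨-, hsA, h, he, hlt⟩ := hs
  classical
  obtain ⟨g, hgg⟩ := exists_affineMap_eq (hA.affineIndependent hsA hc)
    (fun p => if p ∈ u then 0 else -1)
  have hε : ∀ B : Finset Plane, B ⊆ A → (∀ p ∈ B, p ∉ s) →
      ∃ ε : ℝ, 0 < ε ∧ ∀ p ∈ B, h p + ε * g p < ω p := by
    intro B
    induction B using Finset.induction_on with
    | empty => exact fun _ _ => ⟨1, one_pos, by simp⟩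
    | insert a B ha ih =>
      intro hB hBs
      obtain ⟨ε, ε0, hε⟩ := ih (fun p hp => hB (Finset.mem_insert_of_mem hp))
        fun p hp => hBs p (Finset.mem_insert_of_mem hp)
      have hlt' : ∀ p ∈ insert a B, h p < ω p := fun p hp => hlt p (hB hp) (hBs p hp)
      have ha' := hlt' a (Finset.mem_insert_self _ _)
      -- The `+ 1` keeps the denominator positive and also makes the inequality at `a` strict.
      refine ⟨min ε ((ω a - h a) / (|g a| + 1)), lt_min ε0 (by
        have := abs_nonneg (g a); apply div_pos <;> linarith), fun p hp => ?_⟩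
      have hm0 : 0 < min ε ((ω a - h a) / (|g a| + 1)) := lt_min ε0 (by
        have := abs_nonneg (g a); apply div_pos <;> linarith)
      rcases Finset.mem_insert.1 hp with rfl | hpB
      · have h1 := min_le_right ε ((ω p - h p) / (|g p| + 1))
        rw [le_div_iff₀ (by positivity)] at h1
        nlinarith [le_abs_self (g p)]
      · have h1 := min_le_left ε ((ω a - h a) / (|g a| + 1))
        have h2 := hε p hpB
        have h3 := hlt' p hp
        rcases le_total 0 (g p) with h4 | h4
        · nlinarith
        · nlinarith
  obtain ⟨ε, ε0, hε⟩ := hε (A \ s) Finset.sdiff_subset fun p hp => (Finset.mem_sdiff.1 hp).2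
  refine ⟨hne, hu.trans hsA, h + ε • g, fun p hp => ?_, fun p hp hpu => ?_⟩
  · simp [he p (hu hp), hgg p (hu hp), hp]
  · by_cases hps : p ∈ s
    · simp [he p hps, hgg p hps, hpu, ε0]
    · simpa using hε p (Finset.mem_sdiff.2 ⟨hp, hps⟩)

/-- At a common point `x`, comparison on `t` gives `h x ≤ g x`, while `g ≤ h` on the vertices `u ⊆
s` that carry `x`. Hence both functions touch `ω` on `u`, and `u` lies in `s` and in `t`. -/
theorem IsTight.inter_subset {A s t : Finset Plane} {ω : Plane → ℝ} (hs : IsTight A ω s)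
    (ht : IsTight A ω t) : convexHull ℝ (s : Set Plane) ∩ convexHull ℝ (t : Set Plane) ⊆
      convexHull ℝ ((s : Set Plane) ∩ t) := by
  obtain ⟨-, hsA, h, he, hlt⟩ := hs
  obtain ⟨-, htA, g, ge, glt⟩ := ht
  rintro x ⟨hxs, hxt⟩
  have hle : ∀ p ∈ A, h p ≤ ω p := fun p hp => by
    by_cases hps : p ∈ s
    · exact (he p hps).le
    · exact (hlt p hp hps).le
  have hgh : h x ≤ g x :=
    affineMap_le_of_mem_convexHull hxt fun p hp => (hle p (htA hp)).trans (ge p hp).ge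
  obtain ⟨u, hus, hu⟩ := exists_inRel_subset hxs
  have hgle : ∀ p ∈ u, g p ≤ h p := fun p hp => by
    rw [he p (hus hp)]
    by_cases hpt : p ∈ t
    · exact (ge p hpt).le
    · exact (glt p (hsA (hus hp)) hpt).le
  have heq := hu.eq_of_le hgle hgh
  refine convexHull_mono ?_ hu.mem_convexHull
  intro p hp
  refine ⟨hus hp, ?_⟩
  by_contra hpt
  have := glt p (hsA (hus hp)) hpt
  rw [heq p hp, he p (hus hp)] at this
  exact lt_irrefl _ this

/-! ### Lower faces cover the convex hull -/

/-- `x` lies on no line through two points of `A`. -/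
def OffLines (A : Finset Plane) (x : Plane) : Prop :=
  ∀ q ∈ A, ∀ r ∈ A, q ≠ r → x ∉ line[ℝ, q, r]

theorem line_ne_top (q r : Plane) : line[ℝ, q, r] ≠ ⊤ := by
  intro h
  have h1 := collinear_iff_finrank_le_one.1 (collinear_pair ℝ q r)
  rw [← direction_affineSpan, h, AffineSubspace.direction_top] at h1
  simp at h1

theorem dense_offLines (A : Finset Plane) : Dense {x | OffLines A x} := by
  refine MeasureTheory.Measure.dense_of_ae (μ := MeasureTheory.volume) ?_
  simp only [OffLines]
  refine (MeasureTheory.ae_ball_iff A.countable_toSet).2 fun q _ =>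
    (MeasureTheory.ae_ball_iff A.countable_toSet).2 fun r _ => ?_
  have := MeasureTheory.Measure.addHaar_affineSubspace MeasureTheory.volume _ (line_ne_top q r)
  filter_upwards [MeasureTheory.measure_eq_zero_iff_ae_notMem.1 this] with x hx _
  exact hx

theorem isClosed_convexHull_finset (s : Finset Plane) :
    IsClosed (convexHull ℝ (s : Set Plane)) := s.finite_toSet.isClosed_convexHull ℝ

theorem interior_convexHull_nonempty {A : Finset Plane} (hA : InGeneralPosition A)
    (hc : 3 ≤ A.card) : (interior (convexHull ℝ (A : Set Plane))).Nonempty := by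
  obtain ⟨t, ht, htc⟩ := Finset.exists_subset_card_eq hc
  exact (interior_convexHull_nonempty_of_triangle (hA.affineIndependent ht htc.le) htc).mono
    (interior_mono (convexHull_mono (by exact_mod_cast ht)))

/-- Generic points are dense and `conv A` is the closure of its interior, so a closed set need only
be tested at generic points. -/
theorem convexHull_subset_of_offLines {A : Finset Plane} (hA : InGeneralPosition A)
    (hc : 3 ≤ A.card) {C : Set Plane} (hC : IsClosed C)
    (h : ∀ x ∈ convexHull ℝ (A : Set Plane), OffLines A x → x ∈ C) :
    convexHull ℝ (A : Set Plane) ⊆ C := by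
  have h1 : interior (convexHull ℝ (A : Set Plane)) ⊆ C :=
    ((dense_offLines A).open_subset_closure_inter isOpen_interior).trans
      (hC.closure_subset_iff.2 fun x hx => h x (interior_subset hx.1) hx.2)
  rw [← (isClosed_convexHull_finset A).closure_eq,
    ← (convex_convexHull ℝ _).closure_interior_eq_closure_of_nonempty_interior
      (interior_convexHull_nonempty hA hc)]
  exact hC.closure_subset_iff.2 h1

theorem OffLines.card_of_inRel {A u : Finset Plane} {x : Plane} (hx : OffLines A x)
    (hA : 2 ≤ A.card) (hu : u ⊆ A) (hux : InRel u x) : 3 ≤ u.card := by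
  by_contra hc
  have h0 := hux.nonempty.card_pos
  have h4 : u.card = 1 ∨ u.card = 2 := by omega
  rcases h4 with h | h
  · obtain ⟨a, rfl⟩ := Finset.card_eq_one.1 h
    have hxa : x = a := by simpa using hux.mem_convexHull
    obtain ⟨b, hb, hba⟩ := Finset.exists_mem_ne (s := A) (by omega) a
    subst hxa
    exact hx x (hu (by simp)) b hb hba.symm (left_mem_affineSpan_pair ℝ _ _)
  · obtain ⟨a, b, hab, rfl⟩ := Finset.card_eq_two.1 h
    refine hx a (hu (by simp)) b (hu (by simp)) hab ?_
    have := convexHull_subset_affineSpan (𝕜 := ℝ) _ hux.mem_convexHull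
    simpa using this

/-- A simplex pivot: a triangle containing `x` whose plane passes above the lifted point `p` can be
exchanged for a triangle containing `x` with a lower lift at `x`. -/
theorem exists_lower_triangle {A t : Finset Plane} {ω : Plane → ℝ} {x p : Plane}
    (hA : InGeneralPosition A) (ht : t ⊆ A) (htc : t.card = 3) (hx : InRel t x) (hp : p ∈ A)
    (hpt : p ∉ t) {h : Plane →ᵃ[ℝ] ℝ} (he : ∀ q ∈ t, h q = ω q) (hlt : ω p < h p) :
    ∃ t' ⊆ A, t'.card = 3 ∧ ∃ y < h x, (x, y) ∈ liftedHull t' ω := by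
  classical
  obtain ⟨l, l0, l1, rfl⟩ := hx
  obtain ⟨m, m1, m2⟩ := exists_barycentric (hA.affineIndependent ht htc.le) htc p
  have hpos : (t.filter fun q => 0 < m q).Nonempty := by
    by_contra hne
    rw [Finset.not_nonempty_iff_eq_empty, Finset.filter_eq_empty_iff] at hne
    have : ∑ q ∈ t, m q ≤ 0 := Finset.sum_nonpos fun q hq => not_lt.1 (hne hq)
    linarith
  -- The ratio test of the simplex method: `θ` is the largest weight that can be moved to `p` with
  -- the other weights staying nonnegative, and `j` is the vertex that leaves.
  obtain ⟨j, hj, hmin⟩ := Finset.exists_min_image _ (fun q => l q / m q) hpos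
  rw [Finset.mem_filter] at hj
  set θ := l j / m j with hθ
  have θ0 : 0 < θ := div_pos (l0 j hj.1) hj.2
  have hcoef : ∀ q ∈ t, 0 ≤ l q - θ * m q := by
    intro q hq
    rcases lt_or_ge 0 (m q) with hm | hm
    · have := hmin q (Finset.mem_filter.2 ⟨hq, hm⟩)
      rw [le_div_iff₀ hm] at this
      linarith
    · nlinarith [l0 q hq]
  have hjz : l j - θ * m j = 0 := by
    rw [hθ, div_mul_cancel₀ _ hj.2.ne', sub_self]
  have hpe : p ∉ t.erase j := fun h => hpt (Finset.mem_of_mem_erase h)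
  set W : Plane → ℝ := fun q => if q = p then θ else l q - θ * m q with hW
  have hWt : ∀ q ∈ t, W q = l q - θ * m q := fun q hq => by
    have hqp : q ≠ p := fun h => hpt (h ▸ hq)
    simp [hW, hqp]
  have hWp : W p = θ := if_pos rfl
  have hsum : ∀ (f : Plane → ℝ), ∑ q ∈ insert p (t.erase j), W q * f q =
      θ * f p + ∑ q ∈ t, (l q * f q - θ * (m q * f q)) := by
    intro f
    rw [Finset.sum_insert hpe, hWp, ← Finset.add_sum_erase t _ hj.1,
      Finset.sum_congr rfl fun q hq => by rw [hWt q (Finset.mem_of_mem_erase hq)]]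
    have h1 : l j * f j - θ * (m j * f j) = 0 := by
      rw [← mul_assoc, ← sub_mul, hjz, zero_mul]
    rw [h1, zero_add]
    congr 1
    exact Finset.sum_congr rfl fun q _ => by ring
  have hsumv : ∑ q ∈ insert p (t.erase j), W q • q = ∑ q ∈ t, l q • q := by
    rw [Finset.sum_insert hpe, hWp]
    have h1 : ∑ q ∈ t.erase j, W q • q = ∑ q ∈ t, (l q • q - θ • (m q • q)) := by
      rw [← Finset.add_sum_erase t _ hj.1]
      have h1 : l j • j - θ • (m j • j) = 0 := by
        rw [smul_smul, ← sub_smul, hjz, zero_smul]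
      rw [h1, zero_add]
      exact Finset.sum_congr rfl fun q hq => by
        rw [hWt q (Finset.mem_of_mem_erase hq), sub_smul, smul_smul]
    rw [h1, Finset.sum_sub_distrib, ← Finset.smul_sum, m2]
    abel
  refine ⟨insert p (t.erase j), ?_, ?_, ∑ q ∈ insert p (t.erase j), W q * ω q, ?_,
    mem_liftedHull.2 ⟨W, ?_, ?_, hsumv, rfl⟩⟩
  · exact Finset.insert_subset hp ((Finset.erase_subset _ _).trans ht)
  · rw [Finset.card_insert_of_notMem hpe, Finset.card_erase_of_mem hj.1, htc]
  -- The new height is `h x - θ * (h p - ω p)`.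
  · rw [hsum, affineMap_sum h l1, Finset.sum_sub_distrib, ← Finset.mul_sum]
    have e1 : ∑ q ∈ t, l q * ω q = ∑ q ∈ t, l q * h q :=
      Finset.sum_congr rfl fun q hq => by rw [he q hq]
    have e2 : ∑ q ∈ t, m q * ω q = h p := by
      rw [← m2, affineMap_sum h m1]
      exact Finset.sum_congr rfl fun q hq => by rw [he q hq]
    rw [e1, e2]
    nlinarith
  · intro q hq
    rcases Finset.mem_insert.1 hq with rfl | hq
    · rw [hWp]; exact θ0.le
    · rw [hWt q (Finset.mem_of_mem_erase hq)]
      exact hcoef q (Finset.mem_of_mem_erase hq)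
  · have := hsum fun _ => 1
    simp only [mul_one, Finset.sum_sub_distrib, ← Finset.mul_sum, l1, m1] at this
    rw [this]; ring

/-- The height over `x` of an affinely independent lifted simplex is given by interpolation. -/
theorem eq_of_mem_liftedHull {s : Finset Plane} {ω : Plane → ℝ} {h : Plane →ᵃ[ℝ] ℝ}
    (he : ∀ p ∈ s, h p = ω p) {x : Plane} {y : ℝ} (hx : (x, y) ∈ liftedHull s ω) : y = h x := by
  obtain ⟨w, -, w1, rfl, rfl⟩ := mem_liftedHull.1 hx
  rw [affineMap_sum h w1]
  exact Finset.sum_congr rfl fun p hp => by rw [he p hp]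

/-- Among the triangles over `x` take one whose lift is lowest at `x`. A point below its plane would
allow a pivot to a lower triangle, and a fourth point on the plane contradicts genericity. -/
theorem exists_isTight_triangle {A : Finset Plane} {ω : Plane → ℝ} (hA : InGeneralPosition A)
    (hg : IsGeneric A ω) (hc : 3 ≤ A.card) {x : Plane}
    (hx : x ∈ convexHull ℝ (A : Set Plane)) (hoff : OffLines A x) :
    ∃ t, IsTight A ω t ∧ t.card = 3 ∧ x ∈ convexHull ℝ (t : Set Plane) := by
  classical
  have hrel : ∀ t ⊆ A, t.card = 3 → x ∈ convexHull ℝ (t : Set Plane) → InRel t x := by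
    intro t ht htc hxt
    obtain ⟨u, hut, hu⟩ := exists_inRel_subset hxt
    have := hoff.card_of_inRel (by omega) (hut.trans ht) hu
    rwa [Finset.eq_of_subset_of_card_le hut (by omega)] at hu
  choose! H hH using fun (t : Finset Plane) (ht : t ⊆ A ∧ t.card = 3) =>
    exists_affineMap_eq (hA.affineIndependent ht.1 ht.2.le) ω
  have hne : ((A.powersetCard 3).filter
      fun t : Finset Plane => x ∈ convexHull ℝ (t : Set Plane)).Nonempty := by
    -- Carathéodory gives a simplex around `x`; since `x` is off all lines, it has exactly three
    -- vertices.
    rw [convexHull_eq_union] at hx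
    simp only [Set.mem_iUnion] at hx
    obtain ⟨t, htA, hti, hxt⟩ := hx
    obtain ⟨u, hut, hu⟩ := exists_inRel_subset hxt
    have htA' : t ⊆ A := by exact_mod_cast htA
    have h3 := hoff.card_of_inRel (by omega) (hut.trans htA') hu
    have h4 : t.card ≤ 3 := by
      have := hti.card_le_finrank_succ
      have h5 := Submodule.finrank_le (vectorSpan ℝ (Set.range ((↑) : t → Plane)))
      simp at this h5
      omega
    have := Finset.card_le_card hut
    exact ⟨t, Finset.mem_filter.2 ⟨Finset.mem_powersetCard.2 ⟨htA', by omega⟩, hxt⟩⟩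
  obtain ⟨t, ht, hmin⟩ := Finset.exists_min_image _ (fun t => H t x) hne
  rw [Finset.mem_filter, Finset.mem_powersetCard] at ht
  obtain ⟨ht, hxt⟩ := ht
  refine ⟨t, ⟨Finset.card_pos.1 (by omega), ht.1, H t, hH t ht, ?_⟩, ht.2, hxt⟩
  intro p hp hpt
  rcases lt_trichotomy (H t p) (ω p) with h | h | h
  · exact h
  · have := card_le_three_of_eq_affineMap hg (Finset.insert_subset hp ht.1) (H t) (by
      intro q hq
      rcases Finset.mem_insert.1 hq with rfl | hq
      · exact h
      · exact hH t ht q hq)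
    rw [Finset.card_insert_of_notMem hpt] at this
    omega
  · obtain ⟨t', ht', htc', y, hy, hxy⟩ :=
      exists_lower_triangle hA ht.1 ht.2 (hrel t ht.1 ht.2 hxt) hp hpt (hH t ht) h
    have h1 := hmin t' (Finset.mem_filter.2 ⟨Finset.mem_powersetCard.2 ⟨ht', htc'⟩,
      mem_convexHull_of_mem_liftedHull hxy⟩)
    rw [← eq_of_mem_liftedHull (hH t' ⟨ht', htc'⟩) hxy] at h1
    exact absurd h1 (not_le.2 hy)

theorem isTight_of_subset {A s : Finset Plane} (ω : Plane → ℝ) (hA : InGeneralPosition A)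
    (hc : A.card ≤ 3) (hs : s ⊆ A) (hne : s.Nonempty) : IsTight A ω s := by
  classical
  obtain ⟨h, hh⟩ := exists_affineMap_eq (hA.affineIndependent subset_rfl hc)
    (fun p => if p ∈ s then ω p else ω p - 1)
  exact ⟨hne, hs, h, fun p hp => by simp [hh p (hs hp), hp], fun p hp hps => by simp [hh p hp, hps]⟩

theorem exists_isTight_mem_convexHull {A : Finset Plane} {ω : Plane → ℝ}
    (hA : InGeneralPosition A) (hg : IsGeneric A ω) {x : Plane}
    (hx : x ∈ convexHull ℝ (A : Set Plane)) :
    ∃ t, IsTight A ω t ∧ x ∈ convexHull ℝ (t : Set Plane) := by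
  rcases le_or_gt 3 A.card with hc | hc
  · have hfin : {t | IsTight A ω t}.Finite :=
      A.powerset.finite_toSet.subset fun t ht => by simpa using ht.2.1
    have := convexHull_subset_of_offLines hA hc
      (C := ⋃ t ∈ {t | IsTight A ω t}, convexHull ℝ (t : Set Plane))
      (hfin.isClosed_biUnion fun t _ => isClosed_convexHull_finset t) (by
        intro x hx hoff
        obtain ⟨t, ht, -, hxt⟩ := exists_isTight_triangle hA hg hc hx hoff
        exact Set.mem_biUnion ht hxt) hx
    obtain ⟨t, ht, hxt⟩ := Set.mem_iUnion₂.1 this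
    exact ⟨t, ht, hxt⟩
  · obtain ⟨u, hu, hux⟩ := exists_inRel_subset hx
    exact ⟨A, isTight_of_subset ω hA (by omega) subset_rfl (hux.nonempty.mono hu), hx⟩

/-- The lower faces form a triangulation. -/
theorem exists_regular {A : Finset Plane} {ω : Plane → ℝ} (hA : InGeneralPosition A)
    (hg : IsGeneric A ω) : ∃ R : Triangulation A, R.faces = lowerFaces A ω := by
  have hiff := fun s => mem_lowerFaces_iff (s := s) hA hg
  refine ⟨{ faces := lowerFaces A ω, isRelLowerSet_faces := ?_, indep := ?_,
            inter_subset_convexHull := ?_, subset_points := fun s hs => hs.2.1,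
            space_eq := ?_ }, rfl⟩
  · intro s hs
    exact ⟨hs.1, fun u hu hne => (((hiff s).1 hs).mono hA hg hu hne).mem_lowerFaces⟩
  · intro s hs
    exact hA.affineIndependent hs.2.1 (((hiff s).1 hs).card_le hg)
  · intro s t hs ht
    exact ((hiff s).1 hs).inter_subset ((hiff t).1 ht)
  · refine Set.Subset.antisymm ?_ ?_
    · intro x hx
      obtain ⟨s, hs, hxs⟩ := Geometry.SimplicialComplex.mem_space_iff.1 hx
      exact convexHull_mono (by exact_mod_cast hs.2.1) hxs
    · intro x hx
      obtain ⟨t, ht, hxt⟩ := exists_isTight_mem_convexHull hA hg hx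
      exact Geometry.SimplicialComplex.mem_space_iff.2 ⟨t, ht.mem_lowerFaces, hxt⟩

/-! ### Carriers of points in a triangulation -/

namespace Triangulation

variable {A : Finset Plane}

theorem ext_faces {T₁ T₂ : Triangulation A} (h : T₁.faces = T₂.faces) : T₁ = T₂ := by
  obtain ⟨K₁, _, _⟩ := T₁
  obtain ⟨K₂, _, _⟩ := T₂
  obtain rfl : K₁ = K₂ := Geometry.SimplicialComplex.ext h
  rfl

theorem exists_carrier (T : Triangulation A) {x : Plane}
    (hx : x ∈ convexHull ℝ (A : Set Plane)) : ∃ u ∈ T.faces, InRel u x := by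
  rw [← T.space_eq] at hx
  obtain ⟨s, hs, hxs⟩ := Geometry.SimplicialComplex.mem_space_iff.1 hx
  obtain ⟨u, hus, hu⟩ := exists_inRel_subset hxs
  exact ⟨u, T.down_closed hs hus hu.nonempty, hu⟩

/-- The intersection axiom puts `x` in the hull of `u ∩ s`, and unique coordinates then force all of
`u` into it. -/
theorem subset_of_inRel (T : Triangulation A) {u s : Finset Plane} {x : Plane}
    (hu : u ∈ T.faces) (hs : s ∈ T.faces) (hux : InRel u x)
    (hxs : x ∈ convexHull ℝ (s : Set Plane)) : u ⊆ s := by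
  classical
  have h := T.inter_subset_convexHull hu hs ⟨hux.mem_convexHull, hxs⟩
  rw [← Finset.coe_inter] at h
  exact (hux.subset_of_mem (T.indep hu) subset_rfl Finset.inter_subset_left h).trans
    Finset.inter_subset_right

/-- `T₁` already covers `conv A`: a relatively interior point of a face `s` of `T₂` has a carrier in
`T₁`, which belongs to `T₂` too and so has `s` as a face. -/
theorem eq_of_faces_subset {T₁ T₂ : Triangulation A} (h : T₁.faces ⊆ T₂.faces) : T₁ = T₂ := by
  refine ext_faces (h.antisymm fun s hs => ?_)
  obtain ⟨x, hx⟩ := exists_inRel (Geometry.SimplicialComplex.nonempty_of_mem_faces hs)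
  obtain ⟨u, hu, hux⟩ := T₁.exists_carrier (x := x)
    (convexHull_mono (by exact_mod_cast T₂.subset_points s hs) hx.mem_convexHull)
  exact T₁.down_closed hu (T₂.subset_of_inRel hs (h hu) hx hux.mem_convexHull) hx.nonempty

theorem convexHull_subset (T : Triangulation A) {s : Finset Plane} (hs : s ∈ T.faces) :
    convexHull ℝ (s : Set Plane) ⊆ convexHull ℝ (A : Set Plane) :=
  convexHull_mono (by exact_mod_cast T.subset_points s hs)

end Triangulation

theorem InRel.lineMap {u s : Finset Plane} {x y : Plane} (hus : u ⊆ s) (hu : InRel u x)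
    (hs : InRel s y) {ε : ℝ} (h0 : 0 < ε) (h1 : ε ≤ 1) : InRel s (AffineMap.lineMap x y ε) := by
  classical
  obtain ⟨a, a0, a1, rfl⟩ := hu
  obtain ⟨b, b0, b1, rfl⟩ := hs
  have hnn : ∀ p, 0 ≤ (if p ∈ u then a p else 0) := fun p => by
    split_ifs with hp
    · exact (a0 p hp).le
    · exact le_rfl
  refine ⟨fun p => (1 - ε) * (if p ∈ u then a p else 0) + ε * b p, ?_, ?_, ?_⟩
  · intro p hp
    have := b0 p hp
    have := mul_nonneg (sub_nonneg.2 h1) (hnn p)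
    positivity
  · rw [Finset.sum_add_distrib, ← Finset.mul_sum, ← Finset.mul_sum, Finset.sum_ite_mem,
      Finset.inter_eq_right.2 hus, a1, b1]
    ring
  · simp only [add_smul, mul_smul, ite_smul, zero_smul]
    rw [Finset.sum_add_distrib, ← Finset.smul_sum, ← Finset.smul_sum, Finset.sum_ite_mem,
      Finset.inter_eq_right.2 hus, AffineMap.lineMap_apply_module]

/-! ### Replacing a subcomplex -/

/-- A face of a subcomplex triangulating `Z` that is a proper face of an outside simplex lies on
the boundary of `conv Z`, hence belongs to every triangulation of `Z`. -/
theorem mem_faces_of_subset_of_notMem {A Z : Finset Plane} (hA : InGeneralPosition A) (hZ : Z ⊆ A)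
    (hc : 3 ≤ Z.card) {T : Triangulation A} {K₁ K₂ : Triangulation Z} (hK : K₁.faces ⊆ T.faces)
    {u s : Finset Plane} (hu : u ∈ K₁.faces) (hs : s ∈ T.faces) (hsK : s ∉ K₁.faces)
    (hus : u ⊆ s) : u ∈ K₂.faces := by
  obtain ⟨x, hx⟩ := exists_inRel (Geometry.SimplicialComplex.nonempty_of_mem_faces hu)
  obtain ⟨y, hy⟩ := exists_inRel (Geometry.SimplicialComplex.nonempty_of_mem_faces hs)
  have hxZ := K₁.convexHull_subset hu hx.mem_convexHull
  have hint : x ∉ interior (convexHull ℝ (Z : Set Plane)) := by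
    intro hxi
    -- If `x` were interior to `conv Z`, points slightly towards `y` would still be in `conv Z`
    -- while relatively interior to `s`; their carrier in `K₁` would then have `s` as a face.
    have hcont : Filter.Tendsto (fun ε : ℝ => AffineMap.lineMap x y ε) (nhdsWithin 0 (Set.Ioi 0))
        (nhds x) := by
      have : Continuous (fun ε : ℝ => (AffineMap.lineMap x y ε : Plane)) :=
        AffineMap.lineMap_continuous
      simpa using (this.tendsto 0).mono_left nhdsWithin_le_nhds
    have h1 := hcont (mem_interior_iff_mem_nhds.1 hxi)
    have h2 : ∀ᶠ ε : ℝ in nhdsWithin 0 (Set.Ioi 0), ε ∈ Set.Ioc (0 : ℝ) 1 :=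
      Ioc_mem_nhdsGT one_pos
    obtain ⟨ε, hε, hε'⟩ := (h2.and h1).exists
    have hrel := hx.lineMap hus hy hε.1 hε.2
    obtain ⟨k, hk, hkx⟩ := K₁.exists_carrier (by exact hε')
    exact hsK (K₁.down_closed hk (T.subset_of_inRel hs (hK hk) hrel hkx.mem_convexHull) hy.nonempty)
  have hne := interior_convexHull_nonempty (hA.mono hZ) hc
  obtain ⟨f, hf⟩ := geometric_hahn_banach_open_point
    (convex_convexHull ℝ (Z : Set Plane)).interior isOpen_interior hint
  have hfle : ∀ a ∈ convexHull ℝ (Z : Set Plane), f a ≤ f x := by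
    intro a ha
    have hcl : a ∈ closure (interior (convexHull ℝ (Z : Set Plane))) := by
      rw [(convex_convexHull ℝ _).closure_interior_eq_closure_of_nonempty_interior hne]
      exact subset_closure ha
    exact closure_minimal (fun b hb => (hf b hb).le)
      (isClosed_le f.continuous continuous_const) hcl
  let g : Plane →ᵃ[ℝ] ℝ := (f : Plane →ₗ[ℝ] ℝ).toAffineMap
  let c : Plane →ᵃ[ℝ] ℝ := AffineMap.const ℝ Plane (f x)
  obtain ⟨v, hv, hvx⟩ := K₂.exists_carrier hxZ
  have htight : ∀ r ⊆ Z, InRel r x → r ⊆ Z.filter fun p => g p = c p := by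
    intro r hr hrx p hp
    exact Finset.mem_filter.2 ⟨hr hp, hrx.eq_of_le (g := g) (h := c)
      (fun q hq => hfle q (subset_convexHull ℝ _ (hr hq))) le_rfl p hp⟩
  -- Three points of `Z` on the supporting line would already make `g` constant; the weaker bound is
  -- all that affine independence needs.
  have hcard : (Z.filter fun p => g p = c p).card ≤ 3 := by
    by_contra hcc
    obtain ⟨t, ht, htc⟩ :=
      Finset.exists_subset_card_eq (s := Z.filter fun p => g p = c p) (n := 3) (by omega)
    have hti := hA.affineIndependent ((ht.trans (Finset.filter_subset _ _)).trans hZ) htc.le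
    obtain ⟨a, ha⟩ := hne
    exact (hf a ha).ne (affineMap_eq_of_eq_on_triangle hti htc
      (fun p hp => (Finset.mem_filter.1 (ht hp)).2) a)
  -- The carriers of `x` in `K₁` and in `K₂` lie on the supporting line, whose points of `Z` are
  -- affinely independent, so one carrier is contained in the other.
  have hsub := hx.subset_of_mem
    (hA.affineIndependent ((Finset.filter_subset _ _).trans hZ) hcard)
    (htight u (K₁.subset_points u hu) hx) (htight v (K₂.subset_points v hv) hvx)
    hvx.mem_convexHull
  exact K₂.down_closed hv hsub hx.nonempty

/-- Replacing a subcomplex that triangulates `Z` by another triangulation of `Z`. -/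
theorem exists_replace {A Z : Finset Plane} (hA : InGeneralPosition A) (hZ : Z ⊆ A)
    (hc : 3 ≤ Z.card) {T : Triangulation A} {K₁ : Triangulation Z} (K₂ : Triangulation Z)
    (hK : K₁.faces ⊆ T.faces) :
    ∃ T' : Triangulation A, T'.faces = (T.faces \ K₁.faces) ∪ K₂.faces := by
  have hmixed : ∀ s ∈ T.faces \ K₁.faces, ∀ k ∈ K₂.faces,
      convexHull ℝ (s : Set Plane) ∩ convexHull ℝ (k : Set Plane) ⊆
        convexHull ℝ ((s : Set Plane) ∩ k) := by
    rintro s ⟨hs, hsK⟩ k hk x ⟨hxs, hxk⟩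
    -- The carrier of `x` in `K₁` is a face of the outside simplex `s`, hence survives in `K₂` and
    -- is a face of `k` as well.
    obtain ⟨u, hu, hux⟩ := K₁.exists_carrier (K₂.convexHull_subset hk hxk)
    have hus := T.subset_of_inRel (hK hu) hs hux hxs
    have hu₂ : u ∈ K₂.faces := mem_faces_of_subset_of_notMem hA hZ hc hK hu hs hsK hus
    have huk := K₂.subset_of_inRel hu₂ hk hux hxk
    exact convexHull_mono (Set.subset_inter (by exact_mod_cast hus) (by exact_mod_cast huk))
      hux.mem_convexHull
  refine ⟨{ faces := (T.faces \ K₁.faces) ∪ K₂.faces, isRelLowerSet_faces := ?_, indep := ?_,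
            inter_subset_convexHull := ?_, subset_points := ?_, space_eq := ?_ }, rfl⟩
  · rintro s (⟨hs, hsK⟩ | hs)
    · refine ⟨Geometry.SimplicialComplex.nonempty_of_mem_faces hs, fun u hu hne => ?_⟩
      by_cases huK : u ∈ K₁.faces
      · exact Or.inr (mem_faces_of_subset_of_notMem hA hZ hc hK huK hs hsK hu)
      · exact Or.inl ⟨T.down_closed hs hu hne, huK⟩
    · exact ⟨Geometry.SimplicialComplex.nonempty_of_mem_faces hs,
        fun u hu hne => Or.inr (K₂.down_closed hs hu hne)⟩
  · rintro s (⟨hs, -⟩ | hs)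
    · exact T.indep hs
    · exact K₂.indep hs
  · rintro s t (hs | hs) (ht | ht)
    · exact T.inter_subset_convexHull hs.1 ht.1
    · exact hmixed s hs t ht
    · rw [Set.inter_comm, Set.inter_comm (s : Set Plane)]
      exact hmixed t ht s hs
    · exact K₂.inter_subset_convexHull hs ht
  · rintro s (⟨hs, -⟩ | hs)
    · exact T.subset_points s hs
    · exact (K₂.subset_points s hs).trans hZ
  · refine Set.Subset.antisymm ?_ ?_
    · intro x hx
      obtain ⟨s, hs, hxs⟩ := Geometry.SimplicialComplex.mem_space_iff.1 hx
      rcases hs with ⟨hs, -⟩ | hs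
      · exact T.convexHull_subset hs hxs
      · exact convexHull_mono (by exact_mod_cast (K₂.subset_points s hs).trans hZ) hxs
    · intro x hx
      obtain ⟨s, hs, hxs⟩ := T.exists_carrier hx
      rw [Geometry.SimplicialComplex.mem_space_iff]
      by_cases hsK : s ∈ K₁.faces
      · obtain ⟨k, hk, hxk⟩ := K₂.exists_carrier (K₁.convexHull_subset hsK hxs.mem_convexHull)
        exact ⟨k, Or.inr hk, hxk.mem_convexHull⟩
      · exact ⟨s, Or.inl ⟨hs, hsK⟩, hxs.mem_convexHull⟩

/-- The triangle `t` only guarantees that the two triangulations of `Z` differ: if it were both an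
upper and a lower face, the fourth point would lie strictly on both sides of its plane. -/
theorem exists_downFlip {A Z : Finset Plane} {ω : Plane → ℝ} (hA : InGeneralPosition A)
    (hg : IsGeneric A ω) (T : Triangulation A) (hZ : Z ⊆ A) (hc : Z.card = 4)
    (hsub : upperFaces Z ω ⊆ T.faces) {t : Finset Plane} (ht : t ∈ upperFaces Z ω)
    (htc : t.card = 3) : ∃ T' : Triangulation A, IsDownFlip ω T T' := by
  have hA' := hA.mono hZ
  have hg' := hg.mono hZ
  rw [upperFaces_eq_lowerFaces_neg] at hsub ht
  obtain ⟨K₁, hK₁⟩ := exists_regular hA' hg'.neg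
  obtain ⟨K₂, hK₂⟩ := exists_regular hA' hg'
  obtain ⟨T', hT'⟩ := exists_replace hA hZ (by omega) (T := T) K₂ (hK₁.trans_subset hsub)
  refine ⟨T', Z, K₁, K₂, ⟨hZ, hc, ?_, hK₁.trans_subset hsub, hT'⟩, ?_, hK₂⟩
  · rintro rfl
    have ht' : t ∈ lowerFaces Z ω := by rw [← hK₂, hK₁]; exact ht
    obtain ⟨-, htZ, h, he, hlt⟩ := isTight_of_mem_lowerFaces hA' hg' ht'
    obtain ⟨-, -, g, ge, glt⟩ := isTight_of_mem_lowerFaces hA' hg'.neg ht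
    obtain ⟨d, hd, hdt⟩ := Finset.exists_mem_notMem_of_card_lt_card (s := t) (t := Z) (by omega)
    have heq := affineMap_eq_of_eq_on_triangle (hA'.affineIndependent htZ htc.le) htc
      (g := g) (h := -h) (fun p hp => by simp [he p hp, ge p hp]) d
    have h1 := hlt d hd hdt
    have h2 := glt d hd hdt
    simp only [AffineMap.coe_neg, Pi.neg_apply] at heq h2
    linarith
  · rw [hK₁, upperFaces_eq_lowerFaces_neg]

/-! ### The lifted height decreases under down-flips; the partial order -/

variable {A : Finset Plane} {ω : Plane → ℝ}

/-- Both simplices contain the carrier of `x`, where both interpolants equal `ω`. This makes the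
lifted height well defined. -/
theorem Triangulation.eq_of_mem_liftedHull (T : Triangulation A) {s t : Finset Plane}
    (hs : s ∈ T.faces) (ht : t ∈ T.faces) {x : Plane} {y z : ℝ}
    (hy : (x, y) ∈ liftedHull s ω) (hz : (x, z) ∈ liftedHull t ω) : y = z := by
  obtain ⟨g, hg⟩ := exists_affineMap_eq (T.indep hs) ω
  obtain ⟨h, hh⟩ := exists_affineMap_eq (T.indep ht) ω
  have hxs := mem_convexHull_of_mem_liftedHull hy
  have hxt := mem_convexHull_of_mem_liftedHull hz
  obtain ⟨u, hu, hux⟩ := T.exists_carrier (T.convexHull_subset hs hxs)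
  rw [FlipPoset.eq_of_mem_liftedHull hg hy, FlipPoset.eq_of_mem_liftedHull hh hz]
  refine affineMap_eq_of_mem_convexHull hux.mem_convexHull fun p hp => ?_
  rw [hg p (T.subset_of_inRel hu hs hux hxs hp), hh p (T.subset_of_inRel hu ht hux hxt hp)]

/-- The piecewise linear function on `conv A` that interpolates `ω` on the simplices of `T`
(and zero outside `conv A`). -/
noncomputable def Triangulation.liftHeight (T : Triangulation A) (ω : Plane → ℝ) (x : Plane) : ℝ :=
  sInf {y | ∃ s ∈ T.faces, (x, y) ∈ liftedHull s ω}

theorem Triangulation.liftHeight_eq (T : Triangulation A) {s : Finset Plane} (hs : s ∈ T.faces)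
    {x : Plane} {y : ℝ} (hy : (x, y) ∈ liftedHull s ω) : T.liftHeight ω x = y := by
  have : {y | ∃ s ∈ T.faces, (x, y) ∈ liftedHull s ω} = {y} := by
    ext z
    constructor
    · rintro ⟨t, ht, hz⟩
      exact T.eq_of_mem_liftedHull ht hs hz hy
    · rintro rfl
      exact ⟨s, hs, hy⟩
  rw [Triangulation.liftHeight, this, csInf_singleton]

theorem Triangulation.liftHeight_of_notMem (T : Triangulation A) {x : Plane}
    (hx : x ∉ convexHull ℝ (A : Set Plane)) : T.liftHeight ω x = 0 := by
  have : {y | ∃ s ∈ T.faces, (x, y) ∈ liftedHull s ω} = ∅ := by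
    ext z
    simp only [Set.mem_ofPred_eq, Set.mem_empty_iff_false, iff_false, not_exists, not_and]
    exact fun s hs hz => hx (T.convexHull_subset hs (mem_convexHull_of_mem_liftedHull hz))
  rw [Triangulation.liftHeight, this, Real.sInf_empty]

/-- Lower faces bound the lifted tetrahedron from below, which gives the weak inequality. Without a
strict drop, a relatively interior point of any face of `K₁` would lift into a lower face, so that
face would belong to `K₂`, and `K₁ = K₂`. -/
theorem IsDownFlip.liftHeight_lt (hA : InGeneralPosition A) (hg : IsGeneric A ω)
    {T₁ T₂ : Triangulation A} (hf : IsDownFlip ω T₁ T₂) : T₂.liftHeight ω < T₁.liftHeight ω := by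
  obtain ⟨Z, K₁, K₂, ⟨hZ, -, hne, hsub, hrep⟩, -, hlow⟩ := hf
  have hsub₂ : K₂.faces ⊆ T₂.faces := by rw [hrep]; exact Set.subset_union_right
  have hle : ∀ x, T₂.liftHeight ω x ≤ T₁.liftHeight ω x := by
    intro x
    by_cases hx : x ∈ convexHull ℝ (A : Set Plane)
    swap
    · rw [T₁.liftHeight_of_notMem hx, T₂.liftHeight_of_notMem hx]
    obtain ⟨s, hs, hxs⟩ := T₂.exists_carrier hx
    obtain ⟨y, hy⟩ := exists_mem_liftedHull ω hxs.mem_convexHull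
    rw [T₂.liftHeight_eq hs hy]
    rw [hrep] at hs
    rcases hs with ⟨hs, -⟩ | hs
    · rw [T₁.liftHeight_eq hs hy]
    · obtain ⟨k, hk, hxk⟩ := K₁.exists_carrier (K₂.convexHull_subset hs hxs.mem_convexHull)
      obtain ⟨z, hz⟩ := exists_mem_liftedHull ω hxk.mem_convexHull
      rw [T₁.liftHeight_eq (hsub hk) hz]
      rw [hlow] at hs
      obtain ⟨-, -, h, h1, h2⟩ := hs
      rw [h2] at hy
      exact hy.2.trans_le <| h1 (x, z) (liftedHull_mono ω (K₁.subset_points k hk) hz)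
  refine Pi.lt_def.2 ⟨hle, ?_⟩
  by_contra! hge
  refine hne (Triangulation.eq_of_faces_subset fun s hs => ?_)
  obtain ⟨x, hx⟩ := exists_inRel (Geometry.SimplicialComplex.nonempty_of_mem_faces hs)
  obtain ⟨k, hk, hxk⟩ := K₂.exists_carrier (K₁.convexHull_subset hs hx.mem_convexHull)
  obtain ⟨z, hz⟩ := exists_mem_liftedHull ω hxk.mem_convexHull
  have hk' := isTight_of_mem_lowerFaces (hA.mono hZ) (hg.mono hZ) (hlow ▸ hk)
  obtain ⟨-, -, h, he, hlt⟩ := hk'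
  obtain ⟨w, w0, w1, w2⟩ := id hx
  have hy : (x, ∑ p ∈ s, w p * ω p) ∈ liftedHull s ω :=
    mem_liftedHull.2 ⟨w, fun p hp => (w0 p hp).le, w1, w2, rfl⟩
  have hyz := hge x
  rw [T₁.liftHeight_eq (hsub hs) hy, T₂.liftHeight_eq (hsub₂ hk) hz, eq_of_mem_liftedHull he hz,
    ← w2, affineMap_sum h w1] at hyz
  have hsZ := K₁.subset_points s hs
  have heq := eq_of_weighted_sum_le w0 (fun p hp => by
    by_cases hpk : p ∈ k
    · exact (he p hpk).le
    · exact (hlt p (hsZ hp) hpk).le) hyz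
  refine K₂.down_closed hk (fun p hp => ?_) hx.nonempty
  by_contra hpk
  exact (hlt p (hsZ hp) hpk).ne (heq p hp)

theorem liftHeight_le_of_reflTransGen (hA : InGeneralPosition A) (hg : IsGeneric A ω)
    {T₁ T₂ : Triangulation A} (h : Relation.ReflTransGen (IsDownFlip ω) T₁ T₂) :
    T₂ = T₁ ∨ T₂.liftHeight ω < T₁.liftHeight ω := by
  induction h with
  | refl => exact Or.inl rfl
  | tail _ h ih =>
    have h1 := h.liftHeight_lt hA hg
    rcases ih with rfl | ih
    · exact Or.inr h1
    · exact Or.inr (h1.trans ih)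

theorem isPartialOrder_downLE (hA : InGeneralPosition A) (hg : IsGeneric A ω) :
    IsPartialOrder (Triangulation A) (DownLE ω) where
  refl _ := Relation.ReflTransGen.refl
  trans _ _ _ h₁ h₂ := Relation.ReflTransGen.trans h₂ h₁
  antisymm T₁ T₂ h₁ h₂ := by
    rcases liftHeight_le_of_reflTransGen hA hg h₁ with h | h
    · exact h
    · rcases liftHeight_le_of_reflTransGen hA hg h₂ with h' | h'
      · exact h'.symm
      · exact absurd h h'.asymm

instance : Finite (Triangulation A) := by
  have hfin : {F : Set (Finset Plane) | F ⊆ (A.powerset : Set (Finset Plane))}.Finite :=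
    A.powerset.finite_toSet.finite_subsets
  have := hfin.to_subtype
  refine Finite.of_injective (β := {F : Set (Finset Plane) | F ⊆ (A.powerset : Set (Finset Plane))})
    (fun T => ⟨T.faces, fun s hs => by simpa using T.subset_points s hs⟩) fun T₁ T₂ h => ?_
  exact Triangulation.ext_faces (congrArg Subtype.val h)

theorem exists_minimal_of_downFlip (hA : InGeneralPosition A) (hg : IsGeneric A ω)
    (T : Triangulation A) : ∃ M, DownLE ω M T ∧ ∀ T', ¬ IsDownFlip ω M T' := by
  let r : Triangulation A → Triangulation A → Prop :=
    fun T₁ T₂ => T₁.liftHeight ω < T₂.liftHeight ω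
  have : IsTrans _ r := ⟨fun _ _ _ => lt_trans⟩
  have : Std.Irrefl r := ⟨fun _ => lt_irrefl _⟩
  have hwf : WellFounded r := Finite.wellFounded_of_trans_of_irrefl r
  induction T using hwf.induction with
  | h T ih =>
    by_cases h : ∃ T', IsDownFlip ω T T'
    · obtain ⟨T', hT'⟩ := h
      obtain ⟨M, hM, hmin⟩ := ih T' (hT'.liftHeight_lt hA hg)
      exact ⟨M, Relation.ReflTransGen.head hT' hM, hmin⟩
    · exact ⟨T, Relation.ReflTransGen.refl, not_exists.1 h⟩

theorem Triangulation.card_le_three (T : Triangulation A) {s : Finset Plane} (hs : s ∈ T.faces) :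
    s.card ≤ 3 := by
  have h1 := (T.indep hs).card_le_finrank_succ
  have h2 := Submodule.finrank_le (vectorSpan ℝ (Set.range ((↑) : s → Plane)))
  simp at h1 h2
  omega

/-! ### Convex heights: available down-flips -/

/-- A point of `A` that is not a vertex of `T` can be inserted by a down-flip. -/
theorem singleton_mem_faces_or_exists_downFlip (hA : InGeneralPosition A) (hg : IsGeneric A ω)
    (hω : IsConvexHeight A ω) (T : Triangulation A) {p : Plane} (hp : p ∈ A) :
    {p} ∈ T.faces ∨ ∃ T', IsDownFlip ω T T' := by
  classical
  obtain ⟨u, hu, hup⟩ := T.exists_carrier (subset_convexHull ℝ (A : Set Plane) hp)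
  have huA := T.subset_points u hu
  have h0 := hup.nonempty.card_pos
  have h3 := T.card_le_three hu
  by_cases hpu : p ∈ u
  · have := hup.subset_of_mem (T.indep hu) subset_rfl (Finset.singleton_subset_iff.2 hpu)
      (inRel_singleton p).mem_convexHull
    left
    rwa [Finset.Subset.antisymm this (Finset.singleton_subset_iff.2 hpu)] at hu
  have hcases : u.card = 1 ∨ u.card = 2 ∨ u.card = 3 := by omega
  rcases hcases with hc | hc | hc
  · obtain ⟨q, rfl⟩ := Finset.card_eq_one.1 hc
    have : p = q := by simpa using hup.mem_convexHull
    simp [this] at hpu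
  · obtain ⟨a, b, hab, rfl⟩ := Finset.card_eq_two.1 hc
    refine absurd ?_ (hA (insert p {a, b}) (Finset.insert_subset hp huA)
      (by rw [Finset.card_insert_of_notMem hpu, hc]))
    have := convexHull_subset_affineSpan (𝕜 := ℝ) _ hup.mem_convexHull
    simp only [Finset.coe_insert, Finset.coe_singleton] at this ⊢
    exact collinear_insert_of_mem_affineSpan_pair this
  · right
    have hZA : insert p u ⊆ A := Finset.insert_subset hp huA
    have hZc : (insert p u).card = 4 := by rw [Finset.card_insert_of_notMem hpu, hc]
    have hA' := hA.mono hZA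
    have hg' := (hg.mono hZA).neg
    obtain ⟨w, w0, w1, w2⟩ := hup
    have hle : ω p ≤ ∑ q ∈ u, w q * ω q := by
      rw [← w2]
      exact hω.le_sum huA (fun q hq => (w0 q hq).le) w1 (by rwa [w2])
    have hneg : ∑ q ∈ u, w q * (-ω) q = -∑ q ∈ u, w q * ω q := by simp
    refine exists_downFlip hA hg T hZA hZc (t := u) ?_ ?_ hc
    · rw [upperFaces_eq_lowerFaces_neg]
      intro s hs
      have hst := isTight_of_mem_lowerFaces hA' hg' hs
      have hcs := hst.card_le hg'
      obtain ⟨hne, hsZ, h, he, hlt⟩ := hst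
      -- An upper face through `p` would, since `p` lifts to or below the lifted triangle `u`, have
      -- to touch at all of `u` too: four coplanar lifts.
      have hps : p ∉ s := by
        intro hps
        have hhp : ∑ q ∈ u, w q * (-ω) q ≤ ∑ q ∈ u, w q * h q := by
          rw [← affineMap_sum h w1, w2, he p hps, hneg]
          simpa using hle
        have heq := eq_of_weighted_sum_le w0 (fun q hq => by
          by_cases hqs : q ∈ s
          · exact (he q hqs).le
          · exact (hlt q (Finset.mem_insert_of_mem hq) hqs).le) hhp
        have : insert p u ⊆ s := by
          refine Finset.insert_subset hps fun q hq => ?_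
          by_contra hqs
          exact (hlt q (Finset.mem_insert_of_mem hq) hqs).ne (heq q hq)
        have := Finset.card_le_card this
        omega
      refine T.down_closed hu (fun q hq => ?_) hne
      rcases Finset.mem_insert.1 (hsZ hq) with rfl | h
      · exact absurd hq hps
      · exact h
    · rw [upperFaces_eq_lowerFaces_neg]
      obtain ⟨h, he⟩ := exists_affineMap_eq (T.indep hu) (-ω)
      refine IsTight.mem_lowerFaces ⟨Finset.card_pos.1 h0, Finset.subset_insert _ _, h, he, ?_⟩
      intro q hq hqu
      obtain rfl : q = p := by
        rcases Finset.mem_insert.1 hq with h | h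
        · exact h
        · exact absurd h hqu
      have hhq : h q = -∑ q ∈ u, w q * ω q := by
        rw [← hneg]
        conv_lhs => rw [← w2]
        rw [affineMap_sum h w1]
        exact Finset.sum_congr rfl fun r hr => by rw [he r hr]
      refine lt_of_le_of_ne (by rw [hhq]; simpa using hle) fun heq => ?_
      have := card_le_three_of_eq_affineMap hg' subset_rfl h (by
        intro r hr
        rcases Finset.mem_insert.1 hr with rfl | hr
        · exact heq
        · exact he r hr)
      omega

/-- Here `x ≥ 1`, and solving for `a` exhibits it as a convex combination of `d`, `b`, `c`, to which
convexity applies. This excludes non-convex quadrilaterals at an edge that is to be flipped. -/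
theorem IsConvexHeight.le_of_eq_sum (hω : IsConvexHeight A ω) {a b c d : Plane} (ha : a ∈ A)
    (hb : b ∈ A) (hc : c ∈ A) (hd : d ∈ A) {x y z : ℝ} (hsum : x + y + z = 1)
    (hcomb : x • a + y • b + z • c = d) (hy : y ≤ 0) (hz : z ≤ 0) :
    x * ω a + y * ω b + z * ω c ≤ ω d := by
  obtain ⟨f, hf, he⟩ := hω
  have hx : 0 < x := by linarith
  have key := hf.map_sum_le (t := Finset.univ) (w := ![x⁻¹, -y * x⁻¹, -z * x⁻¹]) (p := ![d, b, c])
    (by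
      have := inv_pos.2 hx
      intro i _
      fin_cases i
      · simpa using hx.le
      · simpa using mul_nonneg (neg_nonneg.2 hy) this.le
      · simpa using mul_nonneg (neg_nonneg.2 hz) this.le)
    (by
      simp only [Fin.sum_univ_three, Matrix.cons_val]
      field_simp
      linarith)
    (by
      intro i _
      refine subset_convexHull ℝ _ ?_
      fin_cases i
      · exact hd
      · exact hb
      · exact hc)
  simp only [Fin.sum_univ_three, Matrix.cons_val, smul_eq_mul] at key
  have hpt : x⁻¹ • d + (-y * x⁻¹) • b + (-z * x⁻¹) • c = a := by
    rw [← hcomb]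
    simp only [smul_add, smul_smul, inv_mul_cancel₀ hx.ne', one_smul]
    module
  rw [hpt, he a ha, he b hb, he c hc, he d hd] at key
  have := mul_le_mul_of_nonneg_left key hx.le
  have e : x * (x⁻¹ * ω d + -y * x⁻¹ * ω b + -z * x⁻¹ * ω c) = ω d - y * ω b - z * ω c := by
    field_simp
    ring
  linarith

/-- Two triangles of a triangulation with a common edge lie on different sides of that edge. -/
theorem barycentric_neg_of_adjacent (hA : InGeneralPosition A) (T : Triangulation A)
    {a b c d : Plane} (hab : a ≠ b) (hac : a ≠ c) (hbc : b ≠ c) (had : a ≠ d) (hbd : b ≠ d)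
    (hcd : c ≠ d) (h₁ : {a, b, c} ∈ T.faces) (h₂ : {a, b, d} ∈ T.faces) {x y z : ℝ}
    (hsum : x + y + z = 1) (hcomb : x • a + y • b + z • c = d) : z < 0 := by
  classical
  by_contra! hz
  rcases hz.eq_or_lt with rfl | hz
  · refine hA {a, b, d} (T.subset_points _ h₂)
      (Finset.card_eq_three.2 ⟨a, b, d, hab, had, hbd, rfl⟩) ?_
    have : d ∈ line[ℝ, a, b] := by
      have hd : d = AffineMap.lineMap a b y := by
        rw [← hcomb, AffineMap.lineMap_apply_module, show 1 - y = x by linarith]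
        simp
      rw [hd]
      exact AffineMap.lineMap_mem_affineSpan_pair _ _ _
    have h := collinear_insert_of_mem_affineSpan_pair this
    convert h using 1
    ext q
    simp only [Finset.coe_insert, Finset.coe_singleton, Set.mem_insert_iff, Set.mem_singleton_iff]
    tauto
  -- For `z > 0`, a point near the midpoint of `ab`, moved towards `d` by a fraction `ε`, is
  -- relatively interior to both triangles, which is impossible. The choice of `ε` makes both
  -- coefficients positive.
  · obtain ⟨ε, ε0, ε1, hx, hy⟩ : ∃ ε : ℝ, 0 < ε ∧ ε < 1 ∧ 0 < (1 - ε) / 2 + ε * x ∧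
        0 < (1 - ε) / 2 + ε * y := by
      have hx := neg_abs_le x
      have hy := neg_abs_le y
      have hx0 := abs_nonneg x
      have hy0 := abs_nonneg y
      have hD : 0 < 2 + 2 * |x| + 2 * |y| := by positivity
      have hε := mul_inv_cancel₀ hD.ne'
      have hε0 := inv_pos.2 hD
      set ε := (2 + 2 * |x| + 2 * |y|)⁻¹
      refine ⟨ε, hε0, ?_, ?_, ?_⟩ <;> nlinarith
    have hp : InRel {a, b, d} (((1 - ε) / 2) • a + ((1 - ε) / 2) • b + ε • d) := by
      refine ⟨fun q => if q = d then ε else (1 - ε) / 2, ?_, ?_, ?_⟩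
      · intro q _
        dsimp only
        split_ifs <;> linarith
      · rw [Finset.sum_insert (by simp [hab, had]), Finset.sum_insert (by simp [hbd]),
          Finset.sum_singleton]
        simp only [had, hbd, if_false, if_true]
        ring
      · rw [Finset.sum_insert (by simp [hab, had]), Finset.sum_insert (by simp [hbd]),
          Finset.sum_singleton]
        simp [had, hbd, add_assoc]
    have hq : InRel {a, b, c} (((1 - ε) / 2) • a + ((1 - ε) / 2) • b + ε • d) := by
      refine ⟨fun q => if q = c then ε * z else if q = a then (1 - ε) / 2 + ε * x else
        (1 - ε) / 2 + ε * y, ?_, ?_, ?_⟩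
      · intro q _
        dsimp only
        split_ifs
        · positivity
        · exact hx
        · exact hy
      · rw [Finset.sum_insert (by simp [hab, hac]), Finset.sum_insert (by simp [hbc]),
          Finset.sum_singleton]
        simp only [hac, hbc, hab.symm, if_false, if_true]
        linear_combination ε * hsum
      · rw [Finset.sum_insert (by simp [hab, hac]), Finset.sum_insert (by simp [hbc]),
          Finset.sum_singleton]
        simp only [hac, hbc, hab.symm, if_false, if_true, ← hcomb]
        module
    have := T.subset_of_inRel h₁ h₂ hq hp.mem_convexHull
      (show c ∈ ({a, b, c} : Finset Plane) by simp)
    simp [hac.symm, hbc.symm, hcd] at this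

/-- A locally non-convex edge can be flipped down. -/
theorem exists_downFlip_of_edge (hA : InGeneralPosition A) (hg : IsGeneric A ω)
    (hω : IsConvexHeight A ω) (T : Triangulation A) {a b c d : Plane} (hab : a ≠ b) (hac : a ≠ c)
    (hbc : b ≠ c) (had : a ≠ d) (hbd : b ≠ d) (hcd : c ≠ d) (h₁ : {a, b, c} ∈ T.faces)
    (h₂ : {a, b, d} ∈ T.faces) {h : Plane →ᵃ[ℝ] ℝ} (ha : h a = ω a) (hb : h b = ω b)
    (hc : h c = ω c) (hd : ω d < h d) : ∃ T', IsDownFlip ω T T' := by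
  classical
  have hZA : ({a, b, c, d} : Finset Plane) ⊆ A := by
    have e₁ := T.subset_points _ h₁
    have e₂ := T.subset_points _ h₂
    intro q hq
    simp only [Finset.mem_insert, Finset.mem_singleton] at hq
    rcases hq with rfl | rfl | rfl | rfl
    · exact e₁ (by simp)
    · exact e₁ (by simp)
    · exact e₁ (by simp)
    · exact e₂ (by simp)
  have hZc : ({a, b, c, d} : Finset Plane).card = 4 := by
    rw [Finset.card_insert_of_notMem (by simp [hab, hac, had]),
      Finset.card_insert_of_notMem (by simp [hbc, hbd]), Finset.card_pair hcd]
  have haA : a ∈ A := hZA (by simp)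
  have hbA : b ∈ A := hZA (by simp)
  have hcA : c ∈ A := hZA (by simp)
  have hdA : d ∈ A := hZA (by simp)
  have hc3 : ({a, b, c} : Finset Plane).card = 3 :=
    Finset.card_eq_three.2 ⟨a, b, c, hab, hac, hbc, rfl⟩
  obtain ⟨m, m1, m2⟩ := exists_barycentric (T.indep h₁) hc3 d
  have hsum3 : ∀ g : Plane →ᵃ[ℝ] ℝ, g d = m a * g a + m b * g b + m c * g c := by
    intro g
    conv_lhs => rw [← m2]
    rw [affineMap_sum g m1, Finset.sum_insert (by simp [hab, hac]),
      Finset.sum_insert (by simp [hbc]), Finset.sum_singleton, add_assoc]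
  rw [Finset.sum_insert (by simp [hab, hac]), Finset.sum_insert (by simp [hbc]),
    Finset.sum_singleton, ← add_assoc] at m1 m2
  have hz := barycentric_neg_of_adjacent hA T hab hac hbc had hbd hcd h₁ h₂ m1 m2
  have hhd := hsum3 h
  rw [ha, hb, hc] at hhd
  -- A negative coefficient of `a` would put `b` in the triangle `acd`, and convexity would then
  -- give `h d ≤ ω d`.
  have hma : 0 ≤ m a := by
    by_contra! hneg
    have := hω.le_of_eq_sum hbA haA hcA hdA (x := m b) (y := m a) (z := m c) (by linarith)
      (by rw [← m2]; abel) hneg.le hz.le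
    linarith
  have hmb : 0 ≤ m b := by
    by_contra! hneg
    have := hω.le_of_eq_sum haA hbA hcA hdA m1 m2 hneg.le hz.le
    linarith
  refine exists_downFlip hA hg T hZA hZc (t := {a, b, c}) ?_ ?_ hc3
  · rw [upperFaces_eq_lowerFaces_neg]
    intro s hs
    obtain ⟨hne, hsZ, g, ge, glt⟩ := isTight_of_mem_lowerFaces (hA.mono hZA) (hg.mono hZA).neg hs
    -- The segment `cd` passes below the edge `ab`, so no upper face contains both `c` and `d`;
    -- every upper face is thus a face of one of the two given triangles.
    have hcds : c ∉ s ∨ d ∉ s := by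
      by_contra! hcd
      have hle : ∀ p ∈ ({a, b, c, d} : Finset Plane), g p ≤ -ω p := fun p hp => by
        by_cases hps : p ∈ s
        · exact (ge p hps).le
        · exact (glt p hp hps).le
      have e1 := ge c hcd.1
      have e2 := ge d hcd.2
      have e3 := hle a (by simp)
      have e4 := hle b (by simp)
      have e5 := hsum3 g
      simp only [Pi.neg_apply] at e1 e2
      rw [e1, e2] at e5
      nlinarith
    rcases hcds with hcs | hds
    · refine T.down_closed h₂ (fun q hq => ?_) hne
      have := hsZ hq
      simp only [Finset.mem_insert, Finset.mem_singleton] at this ⊢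
      rcases this with h | h | h | h
      · exact Or.inl h
      · exact Or.inr (Or.inl h)
      · exact absurd (h ▸ hq) hcs
      · exact Or.inr (Or.inr h)
    · refine T.down_closed h₁ (fun q hq => ?_) hne
      have := hsZ hq
      simp only [Finset.mem_insert, Finset.mem_singleton] at this ⊢
      rcases this with h | h | h | h
      · exact Or.inl h
      · exact Or.inr (Or.inl h)
      · exact Or.inr (Or.inr h)
      · exact absurd (h ▸ hq) hds
  · rw [upperFaces_eq_lowerFaces_neg]
    refine IsTight.mem_lowerFaces ⟨by simp, ?_, -h, ?_, ?_⟩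
    · intro q hq
      simp only [Finset.mem_insert, Finset.mem_singleton] at hq ⊢
      tauto
    · intro q hq
      simp only [Finset.mem_insert, Finset.mem_singleton] at hq
      rcases hq with rfl | rfl | rfl <;> simp [ha, hb, hc]
    · intro q hq hq'
      simp only [Finset.mem_insert, Finset.mem_singleton] at hq hq'
      obtain rfl : q = d := by tauto
      simpa using hd

theorem Triangulation.finite_faces (T : Triangulation A) : T.faces.Finite :=
  A.powerset.finite_toSet.subset fun s hs => by simpa using T.subset_points s hs

/-- Generic points have carriers with three vertices, so the finitely many triangles cover `conv A`;
one that contains a relatively interior point of `u` has `u` as a face. -/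
theorem Triangulation.exists_triangle (T : Triangulation A) (hA : InGeneralPosition A)
    (hc : 3 ≤ A.card) {u : Finset Plane} (hu : u ∈ T.faces) :
    ∃ t ∈ T.faces, t.card = 3 ∧ u ⊆ t := by
  have hfin : {t ∈ T.faces | t.card = 3}.Finite := T.finite_faces.subset fun t ht => ht.1
  have hcover := convexHull_subset_of_offLines hA hc
    (C := ⋃ t ∈ {t ∈ T.faces | t.card = 3}, convexHull ℝ (t : Set Plane))
    (hfin.isClosed_biUnion fun t _ => isClosed_convexHull_finset t) (by
      intro x hx hoff
      obtain ⟨v, hv, hvx⟩ := T.exists_carrier hx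
      have h1 := hoff.card_of_inRel (by omega) (T.subset_points v hv) hvx
      have h2 := T.card_le_three hv
      exact Set.mem_biUnion (⟨hv, le_antisymm h2 h1⟩ : v ∈ {t ∈ T.faces | t.card = 3})
        hvx.mem_convexHull)
  obtain ⟨x, hx⟩ := exists_inRel (Geometry.SimplicialComplex.nonempty_of_mem_faces hu)
  obtain ⟨t, ht, hxt⟩ := Set.mem_iUnion₂.1 (hcover (T.convexHull_subset hu hx.mem_convexHull))
  exact ⟨t, ht.1, ht.2, T.subset_of_inRel hu ht.1 hx hxt⟩

/-! ### From local to global convexity -/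

/-- If `T` admits no down-flip then the lifted points lie above the planes of its triangles. -/
theorem affineMap_le_of_forall_not_downFlip (hA : InGeneralPosition A) (hg : IsGeneric A ω)
    (hω : IsConvexHeight A ω) (hc : 3 ≤ A.card) {T : Triangulation A}
    (hT : ∀ T', ¬ IsDownFlip ω T T') {t₀ : Finset Plane} (ht₀ : t₀ ∈ T.faces)
    (htc₀ : t₀.card = 3) {h₀ : Plane →ᵃ[ℝ] ℝ} (he₀ : ∀ q ∈ t₀, h₀ q = ω q) {p : Plane}
    (hp : p ∈ A) : h₀ p ≤ ω p := by
  classical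
  choose! H hH using fun (t : Finset Plane) (ht : t ∈ T.faces) =>
    exists_affineMap_eq (T.indep ht) ω
  rw [← affineMap_eq_of_eq_on_triangle (T.indep ht₀) htc₀ (g := H t₀) (h := h₀)
    (fun q hq => by rw [hH t₀ ht₀ q hq, he₀ q hq]) p]
  by_contra! hbad
  -- Starting off all lines, the segment to `p` meets no vertex before its end and runs along no
  -- edge.
  obtain ⟨x, hoff, hx⟩ : ∃ x, OffLines A x ∧ x ∈ convexHull ℝ (t₀ : Set Plane) := by
    obtain ⟨x, hx, hx'⟩ := (dense_offLines A).inter_open_nonempty _ isOpen_interior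
      (interior_convexHull_nonempty_of_triangle (T.indep ht₀) htc₀)
    exact ⟨x, hx', interior_subset hx⟩
  let γ : ℝ → Plane := fun s => AffineMap.lineMap x p s
  have hγ : Continuous γ := AffineMap.lineMap_continuous
  have hγA : ∀ s ∈ Set.Icc (0 : ℝ) 1, γ s ∈ convexHull ℝ (A : Set Plane) := fun s hs =>
    (convex_convexHull ℝ _).lineMap_mem (T.convexHull_subset ht₀ hx)
      (subset_convexHull ℝ _ hp) hs
  have hγH : ∀ (g : Plane →ᵃ[ℝ] ℝ) (s : ℝ), g (γ s) = g x + s * (g p - g x) := by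
    intro g s
    rw [AffineMap.apply_lineMap, AffineMap.lineMap_apply_ring']
    ring
  -- The bad triangles have planes strictly above the lift of `p`; below, `s` is the last parameter
  -- at which the segment is in a bad triangle `t`.
  let B : Set (Finset Plane) := {t | t ∈ T.faces ∧ t.card = 3 ∧ ω p < H t p}
  have hBfin : B.Finite := T.finite_faces.subset fun t ht => ht.1
  have hcomp : IsCompact (Set.Icc (0 : ℝ) 1 ∩ ⋃ t ∈ B, γ ⁻¹' convexHull ℝ (t : Set Plane)) :=
    isCompact_Icc.inter_right
      (hBfin.isClosed_biUnion fun t _ => (isClosed_convexHull_finset t).preimage hγ)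
  obtain ⟨s, ⟨hs, hsB⟩, hmax⟩ := hcomp.exists_isGreatest ⟨0, by simp, Set.mem_biUnion
    (show t₀ ∈ B from ⟨ht₀, htc₀, hbad⟩) (by simpa [γ] using hx)⟩
  obtain ⟨t, ⟨ht, htc, htp⟩, hst⟩ := Set.mem_iUnion₂.1 hsB
  change γ s ∈ convexHull ℝ (t : Set Plane) at hst
  rcases hs.2.eq_or_lt with rfl | hs1
  · have hγ1 : γ 1 = p := by simp [γ]
    rw [hγ1] at hst
    have hpT := (singleton_mem_faces_or_exists_downFlip hA hg hω T hp).resolve_right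
      (not_exists.2 hT)
    have := T.subset_of_inRel hpT ht (inRel_singleton p) hst (Finset.mem_singleton_self p)
    rw [hH t ht p this] at htp
    exact lt_irrefl _ htp
  -- Simplices are closed and finitely many, so just after `s` only simplices that contain `γ s` can
  -- occur.
  · obtain ⟨r, hsr, hr1, u, hu, hru, hsu⟩ : ∃ r, s < r ∧ r ≤ 1 ∧ ∃ u ∈ T.faces,
        γ r ∈ convexHull ℝ (u : Set Plane) ∧ γ s ∈ convexHull ℝ (u : Set Plane) := by
      have h1 : ∀ᶠ r in nhdsWithin s (Set.Ioi s), ∀ u ∈ T.faces,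
          γ s ∉ convexHull ℝ (u : Set Plane) → γ r ∉ convexHull ℝ (u : Set Plane) := by
        refine (T.finite_faces.eventually_all).2 fun u _ => ?_
        by_cases hsu : γ s ∈ convexHull ℝ (u : Set Plane)
        · exact Filter.Eventually.of_forall fun r h => absurd hsu h
        · have := (isClosed_convexHull_finset u).isOpen_compl.preimage hγ
          filter_upwards [nhdsWithin_le_nhds (this.mem_nhds hsu)] with r hr _
          exact hr
      have h2 : ∀ᶠ r in nhdsWithin s (Set.Ioi s), r ∈ Set.Ioc s 1 := Ioc_mem_nhdsGT hs1
      obtain ⟨r, hr1, hr2⟩ := (h1.and h2).exists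
      obtain ⟨u, hu, hur⟩ := T.exists_carrier (hγA r ⟨hs.1.trans hr2.1.le, hr2.2⟩)
      exact ⟨r, hr2.1, hr2.2, u, hu, hur.mem_convexHull,
        not_not.1 fun h => hr1 u hu h hur.mem_convexHull⟩
    have huB : u ∉ B := fun hB => absurd
      (hmax ⟨⟨hs.1.trans hsr.le, hr1⟩, Set.mem_biUnion hB hru⟩) (not_le.2 hsr)
    have hut : u ≠ t := by
      rintro rfl
      exact huB ⟨ht, htc, htp⟩
    -- The carrier of `γ s` must be an edge shared by `t` and the next triangle `u`.
    obtain ⟨v, hv, hvs⟩ := T.exists_carrier (hγA s hs)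
    have hvu := T.subset_of_inRel hv hu hvs hsu
    have hvt := T.subset_of_inRel hv ht hvs hst
    have hvA := T.subset_points v hv
    have huc := T.card_le_three hu
    have hv0 := hvs.nonempty.card_pos
    have hv3 : v.card ≠ 3 := by
      intro h
      have e1 := Finset.eq_of_subset_of_card_le hvt (by omega)
      have e2 := Finset.eq_of_subset_of_card_le hvu (by omega)
      exact hut (e2.symm.trans e1)
    have hv1 : v.card ≠ 1 := by
      intro h
      obtain ⟨q, rfl⟩ := Finset.card_eq_one.1 h
      have hq : γ s = q := by simpa using hvs.mem_convexHull
      have hqA : q ∈ A := hvA (by simp)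
      have hs0 : 1 - s ≠ 0 := by linarith
      have hxq : x = AffineMap.lineMap q p (-s / (1 - s)) := by
        rw [← hq]
        simp only [γ, AffineMap.lineMap_apply_module]
        match_scalars
        · field_simp
          ring
        · field_simp
          ring
      by_cases hqp : q = p
      · rw [hqp, AffineMap.lineMap_same_apply] at hxq
        have := hoff.card_of_inRel (by omega) (Finset.singleton_subset_iff.2 hp)
          (hxq ▸ inRel_singleton p)
        simp at this
      · exact hoff q hqA p hp hqp (hxq ▸ AffineMap.lineMap_mem_affineSpan_pair _ _ _)
    have hv2 : v.card = 2 := by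
      have := Finset.card_le_card hvt
      omega
    have huv : u.card ≠ 2 := by
      intro h
      obtain rfl : v = u := Finset.eq_of_subset_of_card_le hvu (by omega)
      obtain ⟨a, b, hab, rfl⟩ := Finset.card_eq_two.1 hv2
      have h1 := convexHull_subset_affineSpan (𝕜 := ℝ) _ hsu
      have h2 := convexHull_subset_affineSpan (𝕜 := ℝ) _ hru
      simp only [Finset.coe_insert, Finset.coe_singleton] at h1 h2
      have hrs : r - s ≠ 0 := by linarith
      have hxq : x = AffineMap.lineMap (γ s) (γ r) (-s / (r - s)) := by
        simp only [γ, AffineMap.lineMap_apply_module]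
        match_scalars
        · field_simp
          ring
        · field_simp
          ring
      exact hoff a (hvA (by simp)) b (hvA (by simp)) hab (hxq ▸ AffineMap.lineMap_mem _ h1 h2)
    have hu3 : u.card = 3 := by
      have := Finset.card_le_card hvu
      omega
    have hup : H u p ≤ ω p := not_lt.1 fun h => huB ⟨hu, hu3, h⟩
    obtain ⟨c, hcv, rfl⟩ := Finset.exists_eq_insert_iff.2 ⟨hvt, by omega⟩
    obtain ⟨d, hdv, rfl⟩ := Finset.exists_eq_insert_iff.2 ⟨hvu, by omega⟩
    have hcd : c ≠ d := fun h => hut (by rw [h])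
    have hHv : ∀ q ∈ v, H (insert c v) q = H (insert d v) q := fun q hq => by
      rw [hH _ ht q (Finset.mem_insert_of_mem hq), hH _ hu q (Finset.mem_insert_of_mem hq)]
    have hd : H (insert c v) d ≤ ω d := by
      by_contra! hlt
      obtain ⟨a, b, hab, rfl⟩ := Finset.card_eq_two.1 hv2
      simp only [Finset.mem_insert, Finset.mem_singleton, not_or] at hcv hdv
      have e : ∀ q : Plane, (insert q {a, b} : Finset Plane) = {a, b, q} := fun q => by
        ext; simp only [Finset.mem_insert, Finset.mem_singleton]; tauto
      obtain ⟨T', hT'⟩ := exists_downFlip_of_edge hA hg hω T hab (Ne.symm hcv.1) (Ne.symm hcv.2)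
        (Ne.symm hdv.1) (Ne.symm hdv.2) hcd (by rwa [← e]) (by rwa [← e])
        (hH _ ht a (by simp)) (hH _ ht b (by simp)) (hH _ ht c (by simp)) hlt
      exact hT T' hT'
    -- The two planes agree at `γ s`, and past the common edge that of `u` is not lower. Affinity
    -- extends this to `p`, where the plane of `t` lies strictly above `ω p` and that of `u` does
    -- not.
    have k1 : H (insert c v) (γ r) ≤ H (insert d v) (γ r) :=
      affineMap_le_of_mem_convexHull hru fun q hq => by
        rcases Finset.mem_insert.1 hq with rfl | hq
        · rwa [hH _ hu q (Finset.mem_insert_self _ _)]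
        · exact (hHv q hq).le
    have k2 : H (insert c v) (γ s) = H (insert d v) (γ s) :=
      affineMap_eq_of_mem_convexHull hvs.mem_convexHull hHv
    rw [hγH, hγH] at k1 k2
    have k3 := hup.trans_lt htp
    have k4 : H (insert c v) p - H (insert c v) x ≤ H (insert d v) p - H (insert d v) x := by
      by_contra! hlt
      nlinarith
    nlinarith [mul_nonneg hs.1 (sub_nonneg.2 k4)]

/-- One inclusion suffices, as both are triangulations of `A`. Each triangle is a lower face,
strictly by genericity, and passes this on to its faces; with fewer than three points every nonempty
subset is a lower face. -/
theorem faces_eq_lowerFaces_of_forall_not_downFlip (hA : InGeneralPosition A)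
    (hg : IsGeneric A ω) (hω : IsConvexHeight A ω) {T : Triangulation A}
    (hT : ∀ T', ¬ IsDownFlip ω T T') : T.faces = lowerFaces A ω := by
  obtain ⟨R, hR⟩ := exists_regular hA hg
  suffices T.faces ⊆ R.faces by rw [Triangulation.eq_of_faces_subset this, hR]
  intro u hu
  rw [hR]
  have hne := Geometry.SimplicialComplex.nonempty_of_mem_faces hu
  rcases le_or_gt 3 A.card with hc | hc
  · obtain ⟨t, ht, htc, hut⟩ := T.exists_triangle hA hc hu
    obtain ⟨h, he⟩ := exists_affineMap_eq (T.indep ht) ω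
    have htight : IsTight A ω t := by
      refine ⟨hne.mono hut, T.subset_points t ht, h, he, fun p hp hpt => ?_⟩
      refine lt_of_le_of_ne (affineMap_le_of_forall_not_downFlip hA hg hω hc hT ht htc he hp)
        fun heq => ?_
      classical
      have := card_le_three_of_eq_affineMap hg (Finset.insert_subset hp (T.subset_points t ht)) h (by
        intro q hq
        rcases Finset.mem_insert.1 hq with rfl | hq
        · exact heq
        · exact he q hq)
      rw [Finset.card_insert_of_notMem hpt] at this
      omega
    exact (htight.mono hA hg hut hne).mem_lowerFaces
  · exact (isTight_of_subset ω hA (by omega) (T.subset_points u hu) hne).mem_lowerFaces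

theorem downFlip_poset (hA : InGeneralPosition A) (hg : IsGeneric A ω)
    (hω : IsConvexHeight A ω) :
    IsPartialOrder (Triangulation A) (DownLE ω) ∧
      ∃ R : Triangulation A, R.IsRegularOf ω ∧ IsUniqueMinimum (DownLE ω) R := by
  have hpo := isPartialOrder_downLE hA hg
  obtain ⟨R, hR⟩ := exists_regular hA hg
  have hmin : ∀ T, DownLE ω R T := by
    intro T
    obtain ⟨M, hM, hno⟩ := exists_minimal_of_downFlip hA hg T
    have : M = R := Triangulation.ext_faces <| by
      rw [hR, faces_eq_lowerFaces_of_forall_not_downFlip hA hg hω hno]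
    rwa [← this]
  exact ⟨hpo, R, hR, hmin, fun N hN => hpo.antisymm N R (hN R) (hmin N)⟩

/-! ### Up-flips through the sign change of the heights -/

theorem isUpFlip_iff {A : Finset Plane} {ω : Plane → ℝ} {T₁ T₂ : Triangulation A} :
    IsUpFlip ω T₁ T₂ ↔ IsDownFlip (-ω) T₁ T₂ := by
  simp only [IsUpFlip, IsDownFlip, upperFaces_eq_lowerFaces_neg, neg_neg]

theorem upLE_iff {A : Finset Plane} {ω : Plane → ℝ} {T₁ T₂ : Triangulation A} :
    UpLE ω T₁ T₂ ↔ DownLE (-ω) T₂ T₁ := by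
  have : IsUpFlip (A := A) ω = IsDownFlip (-ω) := by
    ext T₁ T₂
    exact isUpFlip_iff
  rw [UpLE, DownLE, this]

theorem IsConcaveHeight.neg {A : Finset Plane} {ω : Plane → ℝ} (h : IsConcaveHeight A ω) :
    IsConvexHeight A (-ω) := by
  obtain ⟨f, hf, he⟩ := h
  exact ⟨-f, hf.neg, fun p hp => by simp [he p hp]⟩

theorem IsConvexHeight.neg {A : Finset Plane} {ω : Plane → ℝ} (h : IsConvexHeight A ω) :
    IsConcaveHeight A (-ω) := by
  obtain ⟨f, hf, he⟩ := h
  exact ⟨-f, hf.neg, fun p hp => by simp [he p hp]⟩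

theorem upFlip_poset {A : Finset Plane} {ω : Plane → ℝ} (hA : InGeneralPosition A)
    (hg : IsGeneric A ω) (hω : IsConcaveHeight A ω) :
    IsPartialOrder (Triangulation A) (UpLE ω) ∧
      ∃ F : Triangulation A, F.IsFarthestRegularOf ω ∧ IsUniqueMaximum (UpLE ω) F := by
  obtain ⟨hpo, R, hR, hmin, huniq⟩ := downFlip_poset hA hg.neg hω.neg
  have hpo' : IsPartialOrder (Triangulation A) (UpLE ω) :=
    { refl := fun T => upLE_iff.2 (hpo.refl T)
      trans := fun _ _ _ h₁ h₂ => upLE_iff.2 (hpo.trans _ _ _ (upLE_iff.1 h₂) (upLE_iff.1 h₁))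
      antisymm := fun _ _ h₁ h₂ => hpo.antisymm _ _ (upLE_iff.1 h₂) (upLE_iff.1 h₁) }
  refine ⟨hpo', R, ?_, fun T => upLE_iff.2 (hmin T),
    fun N hN => huniq N fun T => upLE_iff.1 (hN T)⟩
  rw [Triangulation.IsFarthestRegularOf, upperFaces_eq_lowerFaces_neg]
  exact hR

/-! ### An up-flip of a diagonal -/

/-- Flipping up the edge `bx`, the lower diagonal of the convex quadrilateral `a b y x`. -/
theorem exists_flip_diagonal {A : Finset Plane} {ω : Plane → ℝ} (hA : InGeneralPosition A)
    (hg : IsGeneric A ω) (T : Triangulation A) {a b x y : Plane}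
    (hcard : ({a, b, x, y} : Finset Plane).card = 4) (h₁ : {a, b, x} ∈ T.faces)
    (h₂ : {b, x, y} ∈ T.faces) (hbx : IsTight A ω {b, x}) {i j k l : ℝ}
    (hi : 0 < i) (hj : 0 < j) (hk : 0 < k) (hl : 0 < l)
    (hdep : ∀ g : Plane →ᵃ[ℝ] ℝ, i * g a + j * g y = k * g b + l * g x)
    (hlow : k * ω b + l * ω x < i * ω a + j * ω y) :
    ∃ T' : Triangulation A, {b, x} ∉ T'.faces ∧
      ∀ s, ¬ s ⊆ {a, b, x, y} → (s ∈ T'.faces ↔ s ∈ T.faces) := by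
  have hZA : ({a, b, x, y} : Finset Plane) ⊆ A := by
    have e₁ := T.subset_points _ h₁
    have e₂ := T.subset_points _ h₂
    intro q hq
    simp only [Finset.mem_insert, Finset.mem_singleton] at hq
    rcases hq with rfl | rfl | rfl | rfl
    · exact e₁ (by simp)
    · exact e₁ (by simp)
    · exact e₁ (by simp)
    · exact e₂ (by simp)
  have hA' := hA.mono hZA
  have hg' := hg.mono hZA
  obtain ⟨K₁, hK₁⟩ := exists_regular hA' hg'
  obtain ⟨K₂, hK₂⟩ := exists_regular hA' hg'.neg
  have hsub : K₁.faces ⊆ T.faces := by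
    rw [hK₁]
    intro s hs
    obtain ⟨hne, hsZ, g, ge, glt⟩ := isTight_of_mem_lowerFaces hA' hg' hs
    have hle : ∀ p ∈ ({a, b, x, y} : Finset Plane), g p ≤ ω p := fun p hp => by
      by_cases hps : p ∈ s
      · exact (ge p hps).le
      · exact (glt p hp hps).le
    -- `hdep` says that the segments `ay` and `bx` cross and `hlow` that `bx` lifts lower there, so
    -- no lower face contains both `a` and `y`.
    have hays : a ∉ s ∨ y ∉ s := by
      by_contra! hay
      have e := hdep g
      rw [ge a hay.1, ge y hay.2] at e
      have e3 := mul_le_mul_of_nonneg_left (hle b (by simp)) hk.le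
      have e4 := mul_le_mul_of_nonneg_left (hle x (by simp)) hl.le
      linarith
    rcases hays with h | h
    · refine T.down_closed h₂ (fun q hq => ?_) hne
      have := hsZ hq
      simp only [Finset.mem_insert, Finset.mem_singleton] at this ⊢
      rcases this with h' | h'
      · exact absurd (h' ▸ hq) h
      · exact h'
    · refine T.down_closed h₁ (fun q hq => ?_) hne
      have := hsZ hq
      simp only [Finset.mem_insert, Finset.mem_singleton] at this ⊢
      rcases this with h' | h' | h' | h'
      · exact Or.inl h'
      · exact Or.inr (Or.inl h')
      · exact Or.inr (Or.inr h')
      · exact absurd (h' ▸ hq) h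
  obtain ⟨T', hT'⟩ := exists_replace hA hZA (by omega) K₂ hsub
  refine ⟨T', ?_, fun s hs => ?_⟩
  · rw [hT', hK₁, hK₂]
    rintro (⟨-, h⟩ | h)
    · refine h (hbx.restrict hZA ?_).mem_lowerFaces
      intro q hq
      simp only [Finset.mem_insert, Finset.mem_singleton] at hq ⊢
      tauto
    · obtain ⟨-, -, g, ge, glt⟩ := isTight_of_mem_lowerFaces hA' hg'.neg h
      have hle : ∀ p ∈ ({a, b, x, y} : Finset Plane), g p ≤ -ω p := fun p hp => by
        by_cases hps : p ∈ ({b, x} : Finset Plane)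
        · exact (ge p hps).le
        · exact (glt p hp hps).le
      have e := hdep g
      rw [ge b (by simp), ge x (by simp)] at e
      simp only [Pi.neg_apply] at e
      have e3 := mul_le_mul_of_nonneg_left (hle a (by simp)) hi.le
      have e4 := mul_le_mul_of_nonneg_left (hle y (by simp)) hj.le
      linarith
  · have n₁ : s ∉ K₁.faces := fun h => hs (K₁.subset_points s h)
    have n₂ : s ∉ K₂.faces := fun h => hs (K₂.subset_points s h)
    rw [hT']
    simp [n₁, n₂]

/-! ### Six points for which no maximum exists -/

namespace Pinwheel

/-- First coordinates of the outer triangle `0, 1, 2` and of the inner triangle `3, 4, 5`. -/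
def X : Fin 6 → ℤ := ![0, 8, 0, 2, 5, 1]

/-- Second coordinates. -/
def Y : Fin 6 → ℤ := ![0, 0, 8, 1, 2, 5]

/-- Heights. -/
def W : Fin 6 → ℤ := ![0, 0, 0, -16, -16, -16]

/-- The six points. -/
noncomputable def P (i : Fin 6) : Plane := !₂[(X i : ℝ), (Y i : ℝ)]

/-- The point set. -/
noncomputable def points : Finset Plane := by
  classical exact Finset.univ.image P

/-- The affine function `(u, v) ↦ α u + β v + γ`. -/
noncomputable def aff (α β γ : ℝ) : Plane →ᵃ[ℝ] ℝ :=
  (α • (EuclideanSpace.proj 0 : Plane →L[ℝ] ℝ).toLinearMap +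
    β • (EuclideanSpace.proj 1 : Plane →L[ℝ] ℝ).toLinearMap).toAffineMap + AffineMap.const ℝ Plane γ

/-- The height function, a maximum of three affine functions. -/
noncomputable def height (p : Plane) : ℝ :=
  -- The three planes support the lower hull along the edges 13, 24 and 05 respectively.
  max (aff 1 (-10) (-8) p) (max (aff 10 11 (-88) p) (aff (-11) (-1) 0 p))

@[simp] theorem P_apply_zero (i : Fin 6) : P i 0 = X i := rfl

@[simp] theorem P_apply_one (i : Fin 6) : P i 1 = Y i := rfl

theorem aff_P (α β γ : ℝ) (i : Fin 6) : aff α β γ (P i) = α * X i + β * Y i + γ := by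
  simp [aff]

theorem injective_P : Function.Injective P := by
  intro i j h
  have h0 : (X i : ℝ) = X j := congrArg (fun p : Plane => p 0) h
  have h1 : (Y i : ℝ) = Y j := congrArg (fun p : Plane => p 1) h
  have hXY : ∀ i j : Fin 6, X i = X j → Y i = Y j → i = j := by decide
  exact hXY i j (by exact_mod_cast h0) (by exact_mod_cast h1)

theorem mem_points {p : Plane} : p ∈ points ↔ ∃ i, P i = p := by
  classical
  simp [points]

theorem height_P (i : Fin 6) : height (P i) = W i := by
  simp only [height, aff_P]
  fin_cases i <;> norm_num [X, Y, W]

theorem exists_coefficients (g : Plane →ᵃ[ℝ] ℝ) :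
    ∃ α β γ : ℝ, ∀ i, g (P i) = α * X i + β * Y i + γ := by
  refine ⟨g.linear !₂[1, 0], g.linear !₂[0, 1], g 0, fun i => ?_⟩
  have hP : P i = (X i : ℝ) • !₂[(1 : ℝ), 0] + (Y i : ℝ) • !₂[(0 : ℝ), 1] := by
    ext j
    fin_cases j <;> simp
  have hd : g (P i) = g.linear (P i) + g 0 := congrFun g.decomp (P i)
  rw [hd, hP, map_add, map_smul, map_smul]
  simp only [smul_eq_mul]
  ring

open scoped Classical in
theorem exists_indices {Z : Finset Plane} (hZ : Z ⊆ points) :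
    ∃ S : Finset (Fin 6), S.image P = Z ∧ S.card = Z.card := by
  obtain ⟨S, -, rfl⟩ := Finset.subset_image_iff.1 (show Z ⊆ Finset.univ.image P by
    intro p hp
    simpa using mem_points.1 (hZ hp))
  exact ⟨S, rfl, (Finset.card_image_of_injective S injective_P).symm⟩

/-- Twice the signed area of the triangle with the given indices. -/
def det (i j k : Fin 6) : ℤ := (X j - X i) * (Y k - Y i) - (Y j - Y i) * (X k - X i)

theorem det_ne_zero : ∀ i j k : Fin 6, i ≠ j → i ≠ k → j ≠ k → det i j k ≠ 0 := by
  decide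

/-- The expression is, up to sign, six times the volume of the lifted tetrahedron, expanded along
the heights. It vanishes for repeated indices, so a witness uses all of `S`. -/
theorem volume_ne_zero : ∀ S : Finset (Fin 6), S.card = 4 → ∃ i ∈ S, ∃ j ∈ S, ∃ k ∈ S, ∃ l ∈ S,
    (W j - W i) * det i k l - (W k - W i) * det i j l + (W l - W i) * det i j k ≠ 0 := by
  decide

theorem inGeneralPosition : InGeneralPosition points := by
  classical
  intro Z hZ hc hcol
  obtain ⟨S, rfl, hS⟩ := exists_indices hZ
  obtain ⟨i, j, k, hij, hik, hjk, rfl⟩ := Finset.card_eq_three.1 (hS.trans hc)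
  obtain ⟨v, hv⟩ := (collinear_iff_of_mem (p₀ := P i) (by simp)).1 hcol
  obtain ⟨r, hr⟩ := hv (P j) (by simp)
  obtain ⟨s, hs⟩ := hv (P k) (by simp)
  have r0 : (X j : ℝ) = r * v 0 + X i := by simpa using congrArg (fun p : Plane => p 0) hr
  have r1 : (Y j : ℝ) = r * v 1 + Y i := by simpa using congrArg (fun p : Plane => p 1) hr
  have s0 : (X k : ℝ) = s * v 0 + X i := by simpa using congrArg (fun p : Plane => p 0) hs
  have s1 : (Y k : ℝ) = s * v 1 + Y i := by simpa using congrArg (fun p : Plane => p 1) hs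
  refine det_ne_zero i j k hij hik hjk ?_
  have : ((det i j k : ℤ) : ℝ) = 0 := by
    rw [det]
    push_cast
    rw [r0, r1, s0, s1]
    ring
  exact_mod_cast this

theorem isGeneric : IsGeneric points height := by
  classical
  rintro Z hZ hc ⟨h, hh⟩
  obtain ⟨S, rfl, hS⟩ := exists_indices hZ
  obtain ⟨i, hi, j, hj, k, hk, l, hl, hne⟩ := volume_ne_zero S (hS.trans hc)
  obtain ⟨α, β, γ, hα⟩ := exists_coefficients h
  have hW : ∀ m ∈ S, (W m : ℝ) = α * X m + β * Y m + γ := fun m hm => by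
    rw [← hα, hh _ (Finset.mem_image_of_mem _ hm), height_P]
  refine hne ?_
  have : (((W j - W i) * det i k l - (W k - W i) * det i j l + (W l - W i) * det i j k : ℤ) : ℝ)
      = 0 := by
    simp only [det]
    push_cast
    rw [hW i hi, hW j hj, hW k hk, hW l hl]
    ring
  exact_mod_cast this

theorem isConvexHeight : IsConvexHeight points height := by
  have haff : ∀ h : Plane →ᵃ[ℝ] ℝ, ConvexOn ℝ (convexHull ℝ (points : Set Plane)) h := fun h =>
    ⟨convex_convexHull ℝ _, fun x _ y _ a b _ _ hab => by
      rw [Convex.combo_affine_apply hab]⟩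
  exact ⟨height, (haff _).sup ((haff _).sup (haff _)), fun _ _ => rfl⟩

-- Clearing the denominator `D` turns the contact conditions into integer statements that `decide`
-- can settle.
open scoped Classical in
theorem isTight_of_certificate {s : Finset (Fin 6)} (hs : s.Nonempty) (α β γ D : ℤ) (hD : 0 < D)
    (h₁ : ∀ i ∈ s, α * X i + β * Y i + γ = D * W i)
    (h₂ : ∀ i ∉ s, α * X i + β * Y i + γ < D * W i) : IsTight points height (s.image P) := by
  have hD' : (0 : ℝ) < D := by exact_mod_cast hD
  have hval : ∀ i, aff (α / D) (β / D) (γ / D) (P i) = (α * X i + β * Y i + γ : ℤ) / D := by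
    intro i
    rw [aff_P]
    push_cast
    ring
  refine ⟨hs.image P, fun p hp => ?_, aff (α / D) (β / D) (γ / D), fun p hp => ?_,
    fun p hp hps => ?_⟩
  · obtain ⟨i, -, rfl⟩ := Finset.mem_image.1 hp
    exact mem_points.2 ⟨i, rfl⟩
  · obtain ⟨i, hi, rfl⟩ := Finset.mem_image.1 hp
    rw [hval, height_P, h₁ i hi, div_eq_iff hD'.ne']
    push_cast
    ring
  · obtain ⟨i, rfl⟩ := mem_points.1 hp
    rw [hval, height_P, div_lt_iff₀ hD']
    have := h₂ i fun hi => hps (Finset.mem_image_of_mem _ hi)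
    rw [mul_comm (W i : ℝ)]
    exact_mod_cast this

theorem isTight_one_three : IsTight points height {P 1, P 3} := by
  simpa using isTight_of_certificate (s := {1, 3}) (by decide) 1 (-10) (-8) 1
    (by decide) (by decide) (by decide)

theorem isTight_two_four : IsTight points height {P 2, P 4} := by
  simpa using isTight_of_certificate (s := {2, 4}) (by decide) 10 11 (-88) 1
    (by decide) (by decide) (by decide)

theorem isTight_zero_five : IsTight points height {P 0, P 5} := by
  simpa using isTight_of_certificate (s := {0, 5}) (by decide) (-11) (-1) 0 1
    (by decide) (by decide) (by decide)

/-- A triangulation with none of the edges `13`, `24`, `05` does not arise by a down-flip, since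
every four points contain one of these edges of the lower hull. -/
theorem not_isDownFlip {T₁ T₂ : Triangulation points} (h13 : {P 1, P 3} ∉ T₂.faces)
    (h24 : {P 2, P 4} ∉ T₂.faces) (h05 : {P 0, P 5} ∉ T₂.faces) :
    ¬ IsDownFlip height T₁ T₂ := by
  classical
  rintro ⟨Z, K₁, K₂, ⟨hZ, hc, -, -, hrep⟩, -, hlow⟩
  obtain ⟨S, rfl, hS⟩ := exists_indices hZ
  have key : ∀ i j : Fin 6, IsTight points height {P i, P j} → i ∈ S → j ∈ S →
      {P i, P j} ∈ T₂.faces := by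
    intro i j ht hi hj
    rw [hrep, hlow]
    refine Or.inr (ht.restrict hZ fun p hp => ?_).mem_lowerFaces
    simp only [Finset.mem_insert, Finset.mem_singleton] at hp
    rcases hp with rfl | rfl
    · exact Finset.mem_image_of_mem _ hi
    · exact Finset.mem_image_of_mem _ hj
  -- Three pairs partition six indices, so four indices contain a whole pair.
  have hpigeon : ∀ S : Finset (Fin 6), S.card = 4 →
      (1 ∈ S ∧ 3 ∈ S) ∨ (2 ∈ S ∧ 4 ∈ S) ∨ (0 ∈ S ∧ 5 ∈ S) := by
    decide
  rcases hpigeon S (hS.trans hc) with h | h | h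
  · exact h13 (key 1 3 isTight_one_three h.1 h.2)
  · exact h24 (key 2 4 isTight_two_four h.1 h.2)
  · exact h05 (key 0 5 isTight_zero_five h.1 h.2)

/-- The first three identities are the crossings of diagonals in the quadrilaterals to be flipped;
the others place the inner points in the outer triangle. -/
theorem affine_dependence (g : Plane →ᵃ[ℝ] ℝ) :
    (9 * g (P 0) + 8 * g (P 4) = 1 * g (P 1) + 16 * g (P 3) ∧
      9 * g (P 1) + 8 * g (P 5) = 1 * g (P 2) + 16 * g (P 4) ∧
      9 * g (P 2) + 8 * g (P 3) = 1 * g (P 0) + 16 * g (P 5)) ∧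
    8 * g (P 3) = 5 * g (P 0) + 2 * g (P 1) + g (P 2) ∧
      8 * g (P 4) = g (P 0) + 5 * g (P 1) + 2 * g (P 2) ∧
      8 * g (P 5) = 2 * g (P 0) + g (P 1) + 5 * g (P 2) := by
  obtain ⟨α, β, γ, h⟩ := exists_coefficients g
  simp only [h, X, Y, Matrix.cons_val]
  push_cast
  refine ⟨⟨?_, ?_, ?_⟩, ?_, ?_, ?_⟩ <;> ring

/-- A triangulation with the inner triangle but none of the edges `13`, `24`, `05`. -/
theorem exists_pinwheel : ∃ T : Triangulation points, {P 1, P 3} ∉ T.faces ∧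
    {P 2, P 4} ∉ T.faces ∧ {P 0, P 5} ∉ T.faces ∧ {P 3, P 4, P 5} ∈ T.faces := by
  classical
  have hA := inGeneralPosition
  have hg := isGeneric
  have hinj : ∀ i j, P i = P j ↔ i = j := fun i j => injective_P.eq_iff
  have hne : ∀ {s t : Finset Plane} (i : Fin 6), P i ∈ s → P i ∉ t → ¬ s ⊆ t :=
    fun _ hs ht h => ht (h hs)
  obtain ⟨R, hR⟩ := exists_regular hA hg
  have h013 : {P 0, P 1, P 3} ∈ R.faces := by
    rw [hR]
    simpa using (isTight_of_certificate (s := {0, 1, 3}) (by decide) 0 (-16) 0 1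
      (by decide) (by decide) (by decide)).mem_lowerFaces
  have h134 : {P 1, P 3, P 4} ∈ R.faces := by
    rw [hR]
    simpa using (isTight_of_certificate (s := {1, 3, 4}) (by decide) 16 (-48) (-128) 9
      (by decide) (by decide) (by decide)).mem_lowerFaces
  have h124 : {P 1, P 2, P 4} ∈ R.faces := by
    rw [hR]
    simpa using (isTight_of_certificate (s := {1, 2, 4}) (by decide) 16 16 (-128) 1
      (by decide) (by decide) (by decide)).mem_lowerFaces
  have h245 : {P 2, P 4, P 5} ∈ R.faces := by
    rw [hR]
    simpa using (isTight_of_certificate (s := {2, 4, 5}) (by decide) 48 64 (-512) 9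
      (by decide) (by decide) (by decide)).mem_lowerFaces
  have h205 : {P 2, P 0, P 5} ∈ R.faces := by
    rw [hR]
    simpa using (isTight_of_certificate (s := {2, 0, 5}) (by decide) (-16) 0 0 1
      (by decide) (by decide) (by decide)).mem_lowerFaces
  have h053 : {P 0, P 5, P 3} ∈ R.faces := by
    rw [hR]
    simpa using (isTight_of_certificate (s := {0, 5, 3}) (by decide) (-64) (-16) 0 9
      (by decide) (by decide) (by decide)).mem_lowerFaces
  have h345 : {P 3, P 4, P 5} ∈ R.faces := by
    rw [hR]
    simpa using (isTight_of_certificate (s := {3, 4, 5}) (by decide) 0 0 (-16) 1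
      (by decide) (by decide) (by decide)).mem_lowerFaces
  -- Each later triangle has a vertex outside the quadrilaterals flipped before, as recorded by
  -- `hne`, and so survives until its turn; the inner triangle survives all three flips.
  obtain ⟨T₁, hn₁, hT₁⟩ := exists_flip_diagonal hA hg R (a := P 0) (b := P 1) (x := P 3) (y := P 4)
    (by simp [hinj]) h013 h134 isTight_one_three (i := 9) (j := 8) (k := 1) (l := 16) (by norm_num)
    (by norm_num) (by norm_num) (by norm_num) (fun g => (affine_dependence g).1.1)
    (by simp only [height_P, W, Matrix.cons_val]; norm_num)
  obtain ⟨T₂, hn₂, hT₂⟩ := exists_flip_diagonal hA hg T₁ (a := P 1) (b := P 2) (x := P 4) (y := P 5)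
    (by simp [hinj]) ((hT₁ _ (hne 2 (by simp) (by simp [hinj]))).2 h124)
    ((hT₁ _ (hne 2 (by simp) (by simp [hinj]))).2 h245) isTight_two_four
    (i := 9) (j := 8) (k := 1) (l := 16) (by norm_num)
    (by norm_num) (by norm_num) (by norm_num) (fun g => (affine_dependence g).1.2.1)
    (by simp only [height_P, W, Matrix.cons_val]; norm_num)
  obtain ⟨T₃, hn₃, hT₃⟩ := exists_flip_diagonal hA hg T₂ (a := P 2) (b := P 0) (x := P 5) (y := P 3)
    (by simp [hinj])
    ((hT₂ _ (hne 0 (by simp) (by simp [hinj]))).2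
      ((hT₁ _ (hne 2 (by simp) (by simp [hinj]))).2 h205))
    ((hT₂ _ (hne 0 (by simp) (by simp [hinj]))).2
      ((hT₁ _ (hne 5 (by simp) (by simp [hinj]))).2 h053)) isTight_zero_five
    (i := 9) (j := 8) (k := 1) (l := 16) (by norm_num)
    (by norm_num) (by norm_num) (by norm_num) (fun g => (affine_dependence g).1.2.2)
    (by simp only [height_P, W, Matrix.cons_val]; norm_num)
  refine ⟨T₃, ?_, ?_, hn₃, ?_⟩
  · rwa [hT₃ _ (hne 1 (by simp) (by simp [hinj])), hT₂ _ (hne 3 (by simp) (by simp [hinj]))]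
  · rwa [hT₃ _ (hne 4 (by simp) (by simp [hinj]))]
  · rwa [hT₃ _ (hne 4 (by simp) (by simp [hinj])), hT₂ _ (hne 3 (by simp) (by simp [hinj])),
      hT₁ _ (hne 5 (by simp) (by simp [hinj]))]

/-- The farthest point triangulation consists of the outer triangle only. -/
theorem exists_outer : ∃ T : Triangulation points, ∀ s ∈ T.faces,
    P 3 ∉ s ∧ P 4 ∉ s ∧ P 5 ∉ s := by
  obtain ⟨U, hU⟩ := exists_regular inGeneralPosition isGeneric.neg
  refine ⟨U, fun s hs => ?_⟩
  rw [hU] at hs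
  obtain ⟨-, -, g, ge, glt⟩ := isTight_of_mem_lowerFaces inGeneralPosition isGeneric.neg hs
  have hle : ∀ i, g (P i) ≤ -W i := fun i => by
    have hi : P i ∈ points := mem_points.2 ⟨i, rfl⟩
    rw [← height_P]
    by_cases his : P i ∈ s
    · exact (ge _ his).le
    · exact (glt _ hi his).le
  have e0 := hle 0
  have e1 := hle 1
  have e2 := hle 2
  obtain ⟨-, d3, d4, d5⟩ := affine_dependence g
  simp only [W, Matrix.cons_val] at e0 e1 e2
  push_cast at e0 e1 e2
  -- `g ≤ 0` at the outer vertices, hence on their hull, whereas touching `-height` at an inner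
  -- point would require the value 16.
  refine ⟨fun h => ?_, fun h => ?_, fun h => ?_⟩
  · have e := ge _ h
    simp only [Pi.neg_apply, height_P, W, Matrix.cons_val] at e
    push_cast at e
    linarith
  · have e := ge _ h
    simp only [Pi.neg_apply, height_P, W, Matrix.cons_val] at e
    push_cast at e
    linarith
  · have e := ge _ h
    simp only [Pi.neg_apply, height_P, W, Matrix.cons_val] at e
    push_cast at e
    linarith

/-- Any triangulation that no down-flip produces would have to equal the maximum. The pinwheel and
the outer triangle are two such, told apart by the inner triangle. -/
theorem not_exists_maximum :
    ¬ ∃ M : Triangulation points, ∀ T : Triangulation points, DownLE height T M := by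
  rintro ⟨M, hM⟩
  have hsource : ∀ T : Triangulation points, {P 1, P 3} ∉ T.faces → {P 2, P 4} ∉ T.faces →
      {P 0, P 5} ∉ T.faces → T = M := by
    intro T h13 h24 h05
    rcases Relation.ReflTransGen.cases_tail (hM T) with h | ⟨T', -, h⟩
    · exact h
    · exact absurd h (not_isDownFlip h13 h24 h05)
  obtain ⟨T, h13, h24, h05, h345⟩ := exists_pinwheel
  obtain ⟨U, hU⟩ := exists_outer
  have hUM := hsource U (fun h => (hU _ h).1 (by simp)) (fun h => (hU _ h).2.1 (by simp))
    fun h => (hU _ h).2.2 (by simp)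
  rw [hsource T h13 h24 h05, ← hUM] at h345
  exact (hU _ h345).1 (by simp)

end Pinwheel

end FlipPoset

open FlipPoset in
theorem mainTheorem2 :
    -- (1) convex heights, poset of down-flips
    ((∀ (A : Finset Plane) (ω : Plane → ℝ),
        InGeneralPosition A → IsGeneric A ω → IsConvexHeight A ω →
          IsPartialOrder (Triangulation A) (DownLE ω) ∧
          ∃ R : Triangulation A, R.IsRegularOf ω ∧ IsUniqueMinimum (DownLE ω) R) ∧
      (∃ (A : Finset Plane) (ω : Plane → ℝ),
        InGeneralPosition A ∧ IsGeneric A ω ∧ IsConvexHeight A ω ∧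
          ¬ ∃ M : Triangulation A, ∀ T : Triangulation A, DownLE ω T M)) ∧
    -- (2) concave heights, poset of up-flips
    ((∀ (A : Finset Plane) (ω : Plane → ℝ),
        InGeneralPosition A → IsGeneric A ω → IsConcaveHeight A ω →
          IsPartialOrder (Triangulation A) (UpLE ω) ∧
          ∃ F : Triangulation A, F.IsFarthestRegularOf ω ∧ IsUniqueMaximum (UpLE ω) F) ∧
      (∃ (A : Finset Plane) (ω : Plane → ℝ),
        InGeneralPosition A ∧ IsGeneric A ω ∧ IsConcaveHeight A ω ∧
          ¬ ∃ M : Triangulation A, ∀ T : Triangulation A, UpLE ω M T)) := by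
  refine ⟨⟨fun A ω hA hg hω => downFlip_poset hA hg hω, Pinwheel.points, Pinwheel.height,
    Pinwheel.inGeneralPosition, Pinwheel.isGeneric, Pinwheel.isConvexHeight,
    Pinwheel.not_exists_maximum⟩, fun A ω hA hg hω => upFlip_poset hA hg hω,
    Pinwheel.points, -Pinwheel.height, Pinwheel.inGeneralPosition, Pinwheel.isGeneric.neg,
    Pinwheel.isConvexHeight.neg, ?_⟩
  rintro ⟨M, hM⟩
  refine Pinwheel.not_exists_maximum ⟨M, fun T => ?_⟩
  have := upLE_iff.1 (hM T)
  rwa [neg_neg] at this
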